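/- Let $ZFC^-$ be $ZFC$ without the power set axiom. Let $M$ be a (not necessarily well-founded) model of $ZFC^- + V=L$ + "there is a largest cardinal $\kappa$, and $\kappa$ is weakly compact", where $\kappa$ is weakly compact iff it is strongly inaccessible and every $\kappa$-tree has a branch. Everything below takes place inside $M$; in particular $\omega$, $L_\alpha$ and "$L_\alpha$ is a model of $ZFC^-$" are those of $M$. Length-$\omega$ construction. Let $\langle A_n, B_n, \xi_n \mid n\in\omega\rangle$ (a sequence in $M$) be such that: - $A_0\subseteq L_\kappa$ is arbitrary, $B_0=\kappa$, and $\xi_0$ is the least ordinal $>\kappa$ such that $A_0\in L_{\xi_0}$ and $L_{\xi_0}$ is a model of $ZFC^-$; - $A_{n+1}=(\{0\}\times A_n)\cup(\{1\}\times B_n)$; - $B_{n+1}$ is a subset of $B_n$ of cardinality $\kappa$ (for instance the $L$-least one) such that every function $F:\kappa\to\gamma$ with $F\in L_{\xi_n}$ and $0<\gamma<\kappa$ is constant on a tail of $B_{n+1}$, i.e. there are $\theta<\kappa$ and $\zeta<\gamma$ with $F(\alpha)=\zeta$ for all $\alpha\in B_{n+1}$ with $\alpha\ge\theta$; - $\xi_{n+1}$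 is the least ordinal $>\xi_n$ such that $A_{n+1}\in L_{\xi_{n+1}}$ and $L_{\xi_{n+1}}$ is a model of $ZFC^-$. Put $\xi_\infty=\sup_{n\in\omega}\xi_n$. For $n\in\omega$ let $[\kappa]^n$ be the set of increasing $n$-tuples of ordinals less than $\kappa$. For $G:\kappa\to\kappa$, an increasing $n$-tuple $\alpha_1<\dots<\alpha_n$ from $\kappa$ is *$G$ spread apart* iff $G(0)<\alpha_1$ and $G(\alpha_{i-1})<\alpha_i$ for $1<i\le n$ (for $n=0$ the condition is void). **Lemma.** Let $\gamma$ be an ordinal with $0<\gamma<\kappa$, let $n\in\omega$, and let $F:[\kappa]^n\to\gamma$ with $F\in L_{\xi_\infty}$. Then there are $m\in\omega$, $G:\kappa\to\kappa$ with $G\in L_{\xi_\infty}$, and $\eta<\gamma$ such that $$F(\alpha_1,\dots,\alpha_n)=\eta$$ whenever $\alpha_1<\dots<\alpha_n$ is an increasing $n$-tuple of elements of $B_m$ which is $G$ spread apart. Moreover, $\eta$ does not depend on the choice of $m$ and $G$: if $(m,G,\eta)$ and $(m',G',\eta')$ both have this property, then $\eta=\eta'$. -/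

import Mathlib

universe u

/-! A (possibly ill-founded) structure `⟨M, ∈ₘ⟩` for the language of set theory.  All set-theoretic
notions below are the usual first-order ones, evaluated *inside* such a structure: sets, functions,
natural numbers, ordinals, formulas etc. are those of `M`. -/

class SetModel (M : Type u) where
  mem : M → M → Prop

infix:50 " ∈ₘ " => SetModel.mem

/-- The set `a` of `M`, regarded as a structure `⟨a, ∈⟩`. -/
instance SetModel.restrict {M : Type u} [SetModel M] (a : M) : SetModel {x : M // x ∈ₘ a} :=
  ⟨fun x y => x.1 ∈ₘ y.1⟩

/-- The only symbol of the language of set theory is the binary predicate `∈`. -/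
inductive SetRelSymb : ℕ → Type
  | mem : SetRelSymb 2

def setLanguage : FirstOrder.Language := ⟨fun _ => Empty, SetRelSymb⟩

instance SetModel.structure {M : Type u} [SetModel M] : setLanguage.Structure M where
  funMap := fun f _ => Empty.elim f
  RelMap := fun r => match r with
    | SetRelSymb.mem => fun v => v 0 ∈ₘ v 1

namespace SetModel

section basic
variable {M : Type u} [SetModel M]

def IsEmptySet (x : M) : Prop := ∀ z : M, ¬ z ∈ₘ x

def SubsetOf (x y : M) : Prop := ∀ z : M, z ∈ₘ x → z ∈ₘ y

/-- `c = {a, b}`. -/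
def IsUPair (a b c : M) : Prop := ∀ z : M, z ∈ₘ c ↔ z = a ∨ z = b

/-- `p` is the Kuratowski pair `{{a}, {a, b}}`. -/
def IsPair (a b p : M) : Prop := ∃ s t : M, IsUPair a a s ∧ IsUPair a b t ∧ IsUPair s t p

/-- `b = a ∪ {a}`. -/
def IsSucc (a b : M) : Prop := ∀ z : M, z ∈ₘ b ↔ z ∈ₘ a ∨ z = a

def IsTransSet (x : M) : Prop := ∀ y : M, y ∈ₘ x → SubsetOf y x

/-- (von Neumann) ordinals, in the presence of the axiom of foundation. -/
def IsOrd (x : M) : Prop := IsTransSet x ∧ ∀ y : M, y ∈ₘ x → IsTransSet y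

def IsLimit (x : M) : Prop := IsOrd x ∧ ¬ IsEmptySet x ∧ ∀ y : M, ¬ IsSucc y x

/-- `n` is a natural number of `M`, i.e. an element of the `ω` of `M`. -/
def IsNat (n : M) : Prop :=
  IsOrd n ∧ ∀ m : M, (m ∈ₘ n ∨ m = n) → IsEmptySet m ∨ ∃ k : M, IsSucc k m

/-- `⟨x, y⟩ ∈ f`; when `f` is a function, this says `f(x) = y`. -/
def Ap (f x y : M) : Prop := ∃ p : M, IsPair x y p ∧ p ∈ₘ f

/-- The set `f` of `M` is a function with domain `{x | D x}` and values in `{y | C y}`. -/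
def IsMap (f : M) (D C : M → Prop) : Prop :=
  (∀ p : M, p ∈ₘ f → ∃ x y : M, D x ∧ C y ∧ IsPair x y p) ∧ ∀ x : M, D x → ∃! y : M, Ap f x y

/-- `f : a → b`. -/
def IsFun (f a b : M) : Prop := IsMap f (fun x => x ∈ₘ a) (fun y => y ∈ₘ b)

/-- In `M` there is a bijection from `a` onto `b`. -/
def Equinum (a b : M) : Prop :=
  ∃ f : M, IsFun f a b ∧ ∀ y : M, y ∈ₘ b → ∃! x : M, Ap f x y

def IsCard (c : M) : Prop := IsOrd c ∧ ∀ b : M, b ∈ₘ c → ¬ Equinum b c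

def IsLargestCard (k : M) : Prop := IsCard k ∧ ∀ c : M, IsCard c → c ∈ₘ k ∨ c = k

/-- Strongly inaccessible: an uncountable regular strong limit cardinal. -/
structure IsInaccessible (k : M) : Prop where
  card : IsCard k
  uncountable : ∃ w : M, (∀ z : M, z ∈ₘ w ↔ IsNat z) ∧ w ∈ₘ k
  regular : ∀ l f : M, l ∈ₘ k → IsFun f l k →
    ∃ b : M, b ∈ₘ k ∧ ∀ x y : M, Ap f x y → y ∈ₘ b
  strongLimit : ∀ l : M, l ∈ₘ k →
    ∃ p c : M, (∀ z : M, z ∈ₘ p ↔ SubsetOf z l) ∧ c ∈ₘ k ∧ Equinum p c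

/-! ### Trees and weak compactness -/

/-- For the relation `R` on `X` (a set of ordered pairs), `t ∈ X` has rank `r`: the set
`seg(t) = {x ∈ X | x R t}` ordered by `R` is isomorphic to the ordinal `r`. -/
def IsRank (X R t r : M) : Prop :=
  IsOrd r ∧ ∃ f : M, IsMap f (fun x => x ∈ₘ X ∧ Ap R x t) (fun y => y ∈ₘ r) ∧
    (∀ y : M, y ∈ₘ r → ∃! x : M, Ap f x y) ∧
    ∀ x x' y y' : M, Ap f x y → Ap f x' y' → (Ap R x x' ↔ y ∈ₘ y')

/-- `⟨X, R⟩` is a `k`-tree: `R` is a transitive relation on `X`, every `seg(t)` is well-ordered by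
`R` in an order type `< k`, and every level below `k` is non-empty and of size `< k`. -/
structure IsKappaTree (k X R : M) : Prop where
  rel : ∀ p : M, p ∈ₘ R → ∃ x y : M, x ∈ₘ X ∧ y ∈ₘ X ∧ IsPair x y p
  trans : ∀ x y z : M, Ap R x y → Ap R y z → Ap R x z
  rank_lt : ∀ t : M, t ∈ₘ X → ∃ r : M, r ∈ₘ k ∧ IsRank X R t r
  level_nonempty : ∀ r : M, r ∈ₘ k → ∃ t : M, t ∈ₘ X ∧ IsRank X R t r
  level_small : ∀ r : M, r ∈ₘ k →
    ∃ T c : M, (∀ t : M, t ∈ₘ T ↔ t ∈ₘ X ∧ IsRank X R t r) ∧ c ∈ₘ k ∧ Equinum T c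

def IsBranch (k X R b : M) : Prop :=
  SubsetOf b X ∧ (∀ r : M, r ∈ₘ k → ∃! t : M, t ∈ₘ b ∧ IsRank X R t r) ∧
    ∀ x y : M, x ∈ₘ b → Ap R y x → y ∈ₘ b

def IsWeaklyCompact (k : M) : Prop :=
  IsInaccessible k ∧ ∀ X R : M, IsKappaTree k X R → ∃ b : M, IsBranch k X R b

/-! ### Definable subsets of a set, inside `M` -/

/-- `s ∈ Aⁿ`. -/
def IsTuple (A n s : M) : Prop := IsFun s n A

/-- `R = {s ∈ Aⁿ | s(i) ∈ s(j)}`. -/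
def IsDiagMem (A n i j R : M) : Prop :=
  ∀ s : M, s ∈ₘ R ↔ IsTuple A n s ∧ ∃ x y : M, Ap s i x ∧ Ap s j y ∧ x ∈ₘ y

/-- `R = {s ∈ Aⁿ | s(i) = s(j)}`. -/
def IsDiagEq (A n i j R : M) : Prop :=
  ∀ s : M, s ∈ₘ R ↔ IsTuple A n s ∧ ∃ x : M, Ap s i x ∧ Ap s j x

/-- `R = Aⁿ \ S`. -/
def IsCompl (A n S R : M) : Prop := ∀ s : M, s ∈ₘ R ↔ IsTuple A n s ∧ ¬ s ∈ₘ S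

/-- `R = S ∩ T`. -/
def IsInter (S T R : M) : Prop := ∀ s : M, s ∈ₘ R ↔ s ∈ₘ S ∧ s ∈ₘ T

/-- `R = {s ∈ Aⁿ | ∃ t ∈ S, t ↾ n = s}`, for `S ⊆ Aⁿ⁺¹`. -/
def IsProj (A n S R : M) : Prop :=
  ∀ s : M, s ∈ₘ R ↔ IsTuple A n s ∧ ∃ t : M, t ∈ₘ S ∧ SubsetOf s t

/-- `d(i) = ⟨n, R⟩`. -/
def Entry (d i n R : M) : Prop := ∃ p : M, IsPair n R p ∧ Ap d i p

/-- `⟨n, R⟩` is atomic (`R = {s ∈ Aⁿ | s(a) ∈ s(b)}` or `R = {s ∈ Aⁿ | s(a) = s(b)}`), or is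
obtained by negation, conjunction or existential quantification from entries of the sequence `d`
before the `i`-th one. -/
def IsDefStep (A d i n R : M) : Prop :=
  (∃ a b : M, a ∈ₘ n ∧ b ∈ₘ n ∧ (IsDiagMem A n a b R ∨ IsDiagEq A n a b R)) ∨
  (∃ j S : M, j ∈ₘ i ∧ Entry d j n S ∧ IsCompl A n S R) ∨
  (∃ j j' S T : M, j ∈ₘ i ∧ j' ∈ₘ i ∧ Entry d j n S ∧ Entry d j' n T ∧ IsInter S T R) ∨
  (∃ j n' S : M, j ∈ₘ i ∧ IsSucc n n' ∧ Entry d j n' S ∧ IsProj A n S R)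

/-- In `M`, `R ⊆ Aⁿ` is first-order definable over `⟨A, ∈⟩` without parameters: `⟨n, R⟩` occurs in
a finite sequence (finite in the sense of `M`) in which every entry arises by `IsDefStep`. -/
def IsDefinableRel (A n R : M) : Prop :=
  ∃ l d : M, IsNat l ∧ IsMap d (fun i => i ∈ₘ l) (fun _ => True) ∧
    (∀ i : M, i ∈ₘ l → ∃ m S : M, IsNat m ∧ Entry d i m S ∧ IsDefStep A d i m S) ∧
    ∃ i : M, i ∈ₘ l ∧ Entry d i n R

/-- `X ∈ Def(A)`: in `M`, the set `X ⊆ A` is first-order definable over `⟨A, ∈⟩` with parameters,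
i.e. `X = {x ∈ A | s⌢⟨x⟩ ∈ R}` for some `s ∈ Aⁿ` and some definable `R ⊆ Aⁿ⁺¹`. -/
def InDef (A X : M) : Prop :=
  SubsetOf X A ∧ ∃ n n' s R : M, IsNat n ∧ IsSucc n n' ∧ IsTuple A n s ∧ IsDefinableRel A n' R ∧
    ∀ x : M, x ∈ₘ A → (x ∈ₘ X ↔ ∃ t : M, t ∈ₘ R ∧ SubsetOf s t ∧ Ap t n x)

/-! ### The constructible hierarchy of `M` -/

/-- `f = ⟨L_b | b ≤ a⟩`, where `L₀ = ∅`, `L_{c+1} = Def(L_c)`, and `L_b = ⋃_{c<b} L_c` for limit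
ordinals `b`. -/
def IsLSeq (a f : M) : Prop :=
  IsMap f (fun b => b ∈ₘ a ∨ b = a) (fun _ => True) ∧
  ∀ b x : M, Ap f b x →
    (IsEmptySet b → IsEmptySet x) ∧
    (∀ c y : M, IsSucc c b → Ap f c y → ∀ z : M, z ∈ₘ x ↔ InDef y z) ∧
    (IsLimit b → ∀ z : M, z ∈ₘ x ↔ ∃ c y : M, c ∈ₘ b ∧ Ap f c y ∧ z ∈ₘ y)

/-- `a` is an ordinal and `l = L_a`. -/
def IsL (a l : M) : Prop := IsOrd a ∧ ∃ f : M, IsLSeq a f ∧ Ap f a l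

/-- `x ∈ L_a`. -/
def InL (x a : M) : Prop := ∃ l : M, IsL a l ∧ x ∈ₘ l

end basic

/-! ### ZFC without power set -/

/-- All the axioms of `ZFC` except power set hold in the structure `N`, where the schemas of
separation and replacement are for the classes in `𝒟`.  This says that `N` is a model of the
first-order theory `ZFC⁻` when `𝒟` consists of the classes definable over `N` with parameters. -/
structure SatZFCMinus (N : Type u) [SetModel N] (𝒟 : Set (Set N)) : Prop where
  extensionality : ∀ x y : N, (∀ z : N, z ∈ₘ x ↔ z ∈ₘ y) → x = y
  foundation : ∀ x : N, ¬ IsEmptySet x → ∃ y : N, y ∈ₘ x ∧ ∀ z : N, z ∈ₘ x → ¬ z ∈ₘ y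
  pairing : ∀ a b : N, ∃ c : N, IsUPair a b c
  union : ∀ a : N, ∃ b : N, ∀ z : N, z ∈ₘ b ↔ ∃ y : N, y ∈ₘ a ∧ z ∈ₘ y
  infinity : ∃ w : N, (∃ e : N, IsEmptySet e ∧ e ∈ₘ w) ∧
    ∀ x : N, x ∈ₘ w → ∃ y : N, IsSucc x y ∧ y ∈ₘ w
  separation : ∀ X ∈ 𝒟, ∀ a : N, ∃ b : N, ∀ z : N, z ∈ₘ b ↔ z ∈ₘ a ∧ z ∈ X
  replacement : ∀ R ∈ 𝒟, ∀ a : N,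
    (∀ x y y' p p' : N, x ∈ₘ a → IsPair x y p → p ∈ R → IsPair x y' p' → p' ∈ R → y = y') →
    ∃ b : N, ∀ y : N, y ∈ₘ b ↔ ∃ x p : N, x ∈ₘ a ∧ IsPair x y p ∧ p ∈ R
  choice : ∀ a : N, (∀ x : N, x ∈ₘ a → ¬ IsEmptySet x) →
    (∀ x y z : N, x ∈ₘ a → y ∈ₘ a → z ∈ₘ x → z ∈ₘ y → x = y) →
    ∃ c : N, ∀ x : N, x ∈ₘ a → ∃! z : N, z ∈ₘ c ∧ z ∈ₘ x

/-- The structure `M` is a model of `ZFC⁻`. -/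
def IsModelOfZFCMinus (M : Type u) [SetModel M] : Prop :=
  SatZFCMinus M {X : Set M | (Set.univ : Set M).Definable₁ setLanguage X}

section construction
variable {M : Type u} [SetModel M]

/-- It holds in `M` that the set `⟨l, ∈⟩` is a model of `ZFC⁻`. -/
def ThinksModelOfZFCMinus (l : M) : Prop :=
  SatZFCMinus {x : M // x ∈ₘ l} {D | ∃ X : M, InDef l X ∧ D = {x | x.1 ∈ₘ X}}

/-- `M` is a model of `ZFC⁻ + V = L + "k is the largest cardinal and is weakly compact"`. -/
structure IsGroundModel (k : M) : Prop where
  zfc : IsModelOfZFCMinus M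
  constructible : ∀ x : M, ∃ a : M, InL x a
  largest : IsLargestCard k
  weaklyCompact : IsWeaklyCompact k

/-- `A ∈ L_x` and `L_x` is a model of `ZFC⁻` (in `M`). -/
def IsGoodLevel (A x : M) : Prop :=
  ∃ l : M, IsL x l ∧ A ∈ₘ l ∧ ThinksModelOfZFCMinus l

/-- `x` is the least ordinal `> b` such that `A ∈ L_x` and `L_x` is a model of `ZFC⁻`. -/
def IsLeastGoodLevelAbove (b A x : M) : Prop :=
  b ∈ₘ x ∧ IsGoodLevel A x ∧ ∀ y : M, b ∈ₘ y → IsGoodLevel A y → x ∈ₘ y ∨ x = y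

/-- `A' = ({0} × A) ∪ ({1} × B)`. -/
def IsDisjUnion (A B A' : M) : Prop :=
  ∀ z : M, z ∈ₘ A' ↔
    (∃ o x : M, IsEmptySet o ∧ x ∈ₘ A ∧ IsPair o x z) ∨
    (∃ o i x : M, IsEmptySet o ∧ IsSucc o i ∧ x ∈ₘ B ∧ IsPair i x z)

/-- `B' ⊆ B` has size `k`, and every `F : k → g` with `0 < g < k` and `F ∈ L_x` is constant on a
tail of `B'`. -/
def IsTailHomogeneous (k x B B' : M) : Prop :=
  SubsetOf B' B ∧ Equinum B' k ∧
  ∀ F g : M, g ∈ₘ k → ¬ IsEmptySet g → IsFun F k g → InL F x →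
    ∃ h v : M, h ∈ₘ k ∧ v ∈ₘ g ∧ ∀ a : M, a ∈ₘ B' → (h ∈ₘ a ∨ h = a) → Ap F a v

/-- The sequences `A = ⟨A_n⟩`, `B = ⟨B_n⟩`, `X = ⟨ξ_n⟩` (`n ∈ ω`) of `M` arise by the length `ω`
construction: `A₀ ⊆ L_k`, `B₀ = k`, `ξ₀` is the least ordinal `> k` such that `A₀ ∈ L_{ξ₀} ⊨ ZFC⁻`;
`A_{n+1} = ({0} × A_n) ∪ ({1} × B_n)`, `B_{n+1}` is a subset of `B_n` of size `k` such that every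
`F : k → g` in `L_{ξ_n}`, `0 < g < k`, is constant on a tail of `B_{n+1}`, and `ξ_{n+1}` is the
least ordinal `> ξ_n` such that `A_{n+1} ∈ L_{ξ_{n+1}} ⊨ ZFC⁻`. -/
structure IsOmegaConstruction (k A B X : M) : Prop where
  seqA : IsMap A IsNat (fun _ => True)
  seqB : IsMap B IsNat (fun _ => True)
  seqX : IsMap X IsNat (fun _ => True)
  zeroA : ∀ o a : M, IsEmptySet o → Ap A o a → ∃ l : M, IsL k l ∧ SubsetOf a l
  zeroB : ∀ o : M, IsEmptySet o → Ap B o k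
  zeroX : ∀ o a x : M, IsEmptySet o → Ap A o a → Ap X o x → IsLeastGoodLevelAbove k a x
  succA : ∀ n n' a b a' : M, IsNat n → IsSucc n n' → Ap A n a → Ap B n b → Ap A n' a' →
    IsDisjUnion a b a'
  succB : ∀ n n' x b b' : M, IsNat n → IsSucc n n' → Ap X n x → Ap B n b → Ap B n' b' →
    IsTailHomogeneous k x b b'
  succX : ∀ n n' x a' x' : M, IsNat n → IsSucc n n' → Ap X n x → Ap A n' a' → Ap X n' x' →
    IsLeastGoodLevelAbove x a' x'

/-- `s` is the supremum of the ordinals `ξ_n`, where `X = ⟨ξ_n | n ∈ ω⟩`. -/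
def IsSupSeq (X s : M) : Prop := ∀ z : M, z ∈ₘ s ↔ ∃ n x : M, Ap X n x ∧ z ∈ₘ x

/-! ### Increasing tuples -/

/-- `s = ⟨s(0), …, s(n-1)⟩` is a strictly increasing `n`-tuple of ordinals `< k`. -/
def IsIncTuple (k n s : M) : Prop :=
  IsTuple k n s ∧ ∀ i j a b : M, i ∈ₘ j → Ap s i a → Ap s j b → a ∈ₘ b

/-- `s` is `G` spread apart: `G(0) < s(0)` and `G(s(i)) < s(i+1)`. -/
def IsSpreadApart (G s : M) : Prop :=
  (∀ o a g : M, IsEmptySet o → Ap s o a → Ap G o g → g ∈ₘ a) ∧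
  ∀ i j a b g : M, IsSucc i j → Ap s i a → Ap s j b → Ap G a g → g ∈ₘ b

/-- `F : [k]^n → g`, where `[k]^n` is the set of increasing `n`-tuples from `k`. -/
def IsPartition (k n g F : M) : Prop := IsMap F (IsIncTuple k n) (fun y => y ∈ₘ g)

/-- `m ∈ ω`, `G : k → k` lies in `L_x`, `h < g`, and `F(s) = h` for every increasing `n`-tuple `s`
from `B_m` which is `G` spread apart. -/
def IsHomogeneityWitness (k B x n g F m G h : M) : Prop :=
  IsNat m ∧ IsFun G k k ∧ InL G x ∧ h ∈ₘ g ∧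
  ∀ b s : M, Ap B m b → IsIncTuple k n s → (∀ i a : M, Ap s i a → a ∈ₘ b) →
    IsSpreadApart G s → Ap F s h

end construction

end SetModel

set_option linter.unusedSectionVars false
set_option synthInstance.maxHeartbeats 400000
set_option synthInstance.maxSize 4000

/-! Existence goes by induction on the length of the tuples, carried out inside `M`. For length 0
there is a single tuple. Let F in L_{ξ_m} be defined on (n+1)-tuples. For each n-tuple s the slice a
↦ F(s⌢a) lies in L_{ξ_{m+1}}, hence is constant on a tail of B_{m+2}; call the constant F'(s)
(`exists_isTailValue`, `exists_tail_partition`). Since B_{m+2} is coded into A_{m+3}, the function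
F' lies in L_{ξ_{m+3}}, and the induction hypothesis gives m', G', η for F'. Fewer than κ tuples
have all entries ≤ α, so inaccessibility gives a single threshold G(α) < κ, also above G'(α), beyond
which F(s⌢a) = F'(s) for all such s and all a in B_{m+2} (`exists_spreading_function`). A G spread
apart tuple from a late enough B_p then restricts to a G' spread apart n-tuple s with F'(s) = η, and
its last entry passes the threshold, so F has value η there (`homogeneity_succ`).

Uniqueness of η holds because the B_m are nested and unbounded: some tuple lies in both sets and is
spread apart for both functions (`homogeneity_unique`).

The remaining work is to see that the objects constructed lie in the levels. A level is a transitive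
set which `M` believes to satisfy ZFC⁻, so its schemas concern classes definable in the sense of
`M`. Formulas of standard length are coded in `M` (`exists_inDef`), and formulas with bounded
quantifiers mean the same in a level and in `M`. `DefPred j` therefore records definability over a
structure embedded transitively by `j`, and instance search derives it; `j = id` is the case of `M`
itself, needed for induction in a possibly nonstandard ω. -/

namespace SetModel

/-! ### First-order definability and its behaviour under transitive embeddings. -/

section definability

/-- The subsets of `Nᵏ` that are first-order definable over `⟨N, ∈⟩` without parameters. -/
inductive Dfn (N : Type u) [SetModel N] : (k : ℕ) → Set (Fin k → N) → Prop
  | mem {k : ℕ} (i j : Fin k) : Dfn N k {v | v i ∈ₘ v j}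
  | eq {k : ℕ} (i j : Fin k) : Dfn N k {v | v i = v j}
  | compl {k : ℕ} {X : Set (Fin k → N)} : Dfn N k X → Dfn N k Xᶜ
  | inter {k : ℕ} {X Y : Set (Fin k → N)} : Dfn N k X → Dfn N k Y → Dfn N k (X ∩ Y)
  | proj {k : ℕ} {X : Set (Fin (k + 1) → N)} : Dfn N (k + 1) X →
      Dfn N k {v | ∃ x, Fin.snoc (α := fun _ => N) v x ∈ X}

variable {N : Type u} [SetModel N]

theorem Dfn.rename {k : ℕ} {X : Set (Fin k → N)} (h : Dfn N k X) :
    ∀ {m : ℕ} (f : Fin k → Fin m), Dfn N m {v | v ∘ f ∈ X} := by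
  induction h with
  | mem i j => exact fun f => Dfn.mem (f i) (f j)
  | eq i j => exact fun f => Dfn.eq (f i) (f j)
  | compl _ ih => exact fun f => (ih f).compl
  | inter _ _ ih ih' => exact fun f => (ih f).inter (ih' f)
  | @proj k X _ ih =>
    intro m f
    convert (ih (Fin.snoc (α := fun _ => Fin (m + 1)) (Fin.castSucc ∘ f) (Fin.last m))).proj
      using 1
    ext v
    refine exists_congr fun x => ?_
    have : (Fin.snoc (α := fun _ => N) v x) ∘
        (Fin.snoc (α := fun _ => Fin (m + 1)) (Fin.castSucc ∘ f) (Fin.last m)) =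
        Fin.snoc (α := fun _ => N) (v ∘ f) x := by
      funext i
      refine Fin.lastCases ?_ (fun i => ?_) i <;> simp
    simp [this]

theorem Dfn.definable {k : ℕ} {X : Set (Fin k → N)} (h : Dfn N k X) :
    (∅ : Set N).Definable setLanguage X := by
  induction h with
  | mem i j =>
    refine ⟨FirstOrder.Language.Relations.formula
      (Sum.inl SetRelSymb.mem : (setLanguage.withConstants (∅ : Set N)).Relations 2)
      ![FirstOrder.Language.Term.var i, FirstOrder.Language.Term.var j], ?_⟩
    ext v
    exact Iff.rfl
  | eq i j =>
    refine ⟨FirstOrder.Language.Term.equal (FirstOrder.Language.Term.var i)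
      (FirstOrder.Language.Term.var j), ?_⟩
    ext v
    simp
  | compl _ ih => exact ih.compl
  | inter _ _ ih ih' => exact ih.inter ih'
  | @proj k X _ ih =>
    convert ih.image_comp (Fin.castSucc : Fin k → Fin (k + 1)) using 1
    ext v
    constructor
    · rintro ⟨x, hx⟩
      exact ⟨_, hx, by funext i; simp⟩
    · rintro ⟨w, hw, rfl⟩
      refine ⟨w (Fin.last k), ?_⟩
      convert hw using 1
      funext i
      refine Fin.lastCases ?_ (fun i => ?_) i <;> simp

theorem Dfn.definable₁ {k : ℕ} {X : Set (Fin (k + 1) → N)} (h : Dfn N (k + 1) X)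
    (c : Fin k → N) :
    (Set.univ : Set N).Definable₁ setLanguage {x | Fin.snoc (α := fun _ => N) c x ∈ X} := by
  obtain ⟨φ, hφ⟩ := Set.empty_definable_iff.1 h.definable
  refine Set.definable_iff_exists_formula_sum.2 ⟨φ.relabel
    (Fin.snoc (α := fun _ => (Set.univ : Set N) ⊕ Fin 1) (fun i => Sum.inl ⟨c i, trivial⟩)
      (Sum.inr 0)), ?_⟩
  ext v
  rw [hφ]
  simp only [Set.mem_ofPred_eq, FirstOrder.Language.Formula.realize_relabel]
  apply iff_of_eq
  congr 1
  funext i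
  refine Fin.lastCases ?_ (fun i => ?_) i <;> simp

variable {M : Type u} [SetModel M]

/-- An isomorphism of `N` onto a transitive substructure of `M`. -/
class IsTransEmb (j : N → M) : Prop where
  inj : ∀ x y, j x = j y → x = y
  mem : ∀ x y, j x ∈ₘ j y ↔ x ∈ₘ y
  trans : ∀ (x : M) (y : N), x ∈ₘ j y → ∃ x', j x' = x

instance : IsTransEmb (id : M → M) := ⟨fun _ _ h => h, fun _ _ => Iff.rfl, fun x _ _ => ⟨x, rfl⟩⟩

class InRange (j : N → M) (c : M) : Prop where
  out : ∃ c', j c' = c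

instance (c : M) : InRange (id : M → M) c := ⟨c, rfl⟩

/-- `f` is a variable or a constant in the range of `j`. -/
class DefTerm (j : N → M) {n : ℕ} (f : (Fin n → M) → M) : Prop where
  out : (∃ i, ∀ v, f v = v i) ∨ ∃ c, ∀ v, f v = j c

/-- The predicate `P`, restricted to the range of `j`, is definable over `N` with parameters. -/
class DefPred (j : N → M) {n : ℕ} (P : (Fin n → M) → Prop) : Prop where
  out : ∃ (k : ℕ) (c : Fin k → N) (X : Set (Fin (k + n) → N)), Dfn N (k + n) X ∧
    ∀ v : Fin n → N, P (fun i => j (v i)) ↔ Fin.append c v ∈ X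

section
variable {j : N → M} {n : ℕ}

instance DefTerm.var (i : Fin n) : DefTerm j (fun v : Fin n → M => v i) := ⟨.inl ⟨i, fun _ => rfl⟩⟩

instance (priority := high) DefTerm.const (c : M) [h : InRange j c] : DefTerm j (fun _ : Fin n → M => c) :=
  ⟨.inr (h.out.imp fun _ h _ => h.symm)⟩

instance (priority := low) DefTerm.lift {m : ℕ} (f : (Fin n → M) → M) [h : DefTerm j f]
    (e : Fin n → Fin m) : DefTerm j (fun w : Fin m → M => f (fun i => w (e i))) :=
  ⟨h.out.imp (fun ⟨i, hi⟩ => ⟨e i, fun _ => hi _⟩) (fun ⟨c, hc⟩ => ⟨c, fun _ => hc _⟩)⟩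

theorem DefTerm.exists_index {f : (Fin n → M) → M} (h : DefTerm j f) :
    ∃ (k : ℕ) (c : Fin k → N) (i : Fin (k + n)), ∀ v : Fin n → N,
      f (fun i => j (v i)) = j (Fin.append c v i) := by
  rcases h.out with ⟨i, hi⟩ | ⟨c, hc⟩
  · exact ⟨0, Fin.elim0, Fin.natAdd 0 i, fun v => by rw [hi, Fin.append_right]⟩
  · exact ⟨1, fun _ => c, Fin.castAdd n 0, fun v => by rw [hc, Fin.append_left]⟩

/-- The variables of a formula with `k` parameters, among those of one with `k + l` parameters. -/
def leftVars (k l n : ℕ) : Fin (k + n) → Fin (k + l + n) :=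
  Fin.addCases (motive := fun _ => Fin (k + l + n))
    (fun i => Fin.castAdd n (Fin.castAdd l i)) (fun i => Fin.natAdd (k + l) i)

/-- The variables of a formula with `l` parameters, among those of one with `k + l` parameters. -/
def rightVars (k l n : ℕ) : Fin (l + n) → Fin (k + l + n) :=
  Fin.addCases (motive := fun _ => Fin (k + l + n))
    (fun i => Fin.castAdd n (Fin.natAdd k i)) (fun i => Fin.natAdd (k + l) i)

theorem append_comp_leftVars {k l : ℕ} (c : Fin k → N) (d : Fin l → N) (v : Fin n → N) :
    Fin.append (Fin.append c d) v ∘ leftVars k l n = Fin.append c v := by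
  funext i
  refine Fin.addCases (fun i => ?_) (fun i => ?_) i <;> simp [leftVars]

theorem append_comp_rightVars {k l : ℕ} (c : Fin k → N) (d : Fin l → N) (v : Fin n → N) :
    Fin.append (Fin.append c d) v ∘ rightVars k l n = Fin.append d v := by
  funext i
  refine Fin.addCases (fun i => ?_) (fun i => ?_) i <;> simp [rightVars]

theorem DefPred.congr {P Q : (Fin n → M) → Prop} (h : DefPred j P) (hPQ : ∀ v, Q v ↔ P v) :
    DefPred j Q := by
  obtain ⟨k, c, X, hX, h⟩ := h.out
  exact ⟨k, c, X, hX, fun v => (hPQ _).trans (h v)⟩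

theorem DefPred.rename {P : (Fin n → M) → Prop} (h : DefPred j P) {m : ℕ} (e : Fin n → Fin m) :
    DefPred j (fun w => P (fun i => w (e i))) := by
  obtain ⟨k, c, X, hX, h⟩ := h.out
  refine ⟨k, c, _, hX.rename (Fin.addCases (motive := fun _ => Fin (k + m))
    (fun i => Fin.castAdd m i) (fun i => Fin.natAdd k (e i))), fun v => (h fun i => v (e i)).trans ?_⟩
  apply iff_of_eq
  show _ = (_ ∈ X)
  congr 1
  funext i
  refine Fin.addCases (fun i => ?_) (fun i => ?_) i <;> simp

instance DefPred.mem [hj : IsTransEmb j] (f g : (Fin n → M) → M) [hf : DefTerm j f]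
    [hg : DefTerm j g] : DefPred j (fun v => f v ∈ₘ g v) := by
  obtain ⟨k, c, a, ha⟩ := hf.exists_index
  obtain ⟨l, d, b, hb⟩ := hg.exists_index
  refine ⟨k + l, Fin.append c d, _, Dfn.mem (leftVars k l n a) (rightVars k l n b), fun v => ?_⟩
  rw [ha, hb, hj.mem, ← append_comp_leftVars c d v, ← append_comp_rightVars c d v]
  rfl

instance DefPred.eq [hj : IsTransEmb j] (f g : (Fin n → M) → M) [hf : DefTerm j f]
    [hg : DefTerm j g] : DefPred j (fun v => f v = g v) := by
  obtain ⟨k, c, a, ha⟩ := hf.exists_index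
  obtain ⟨l, d, b, hb⟩ := hg.exists_index
  refine ⟨k + l, Fin.append c d, _, Dfn.eq (leftVars k l n a) (rightVars k l n b), fun v => ?_⟩
  rw [ha, hb, ← append_comp_leftVars c d v, ← append_comp_rightVars c d v]
  exact ⟨hj.inj _ _, congrArg j⟩

instance DefPred.not (P : (Fin n → M) → Prop) [h : DefPred j P] : DefPred j (fun v => ¬ P v) := by
  obtain ⟨k, c, X, hX, h⟩ := h.out
  exact ⟨k, c, _, hX.compl, fun v => not_congr (h v)⟩

instance DefPred.and (P Q : (Fin n → M) → Prop) [hP : DefPred j P] [hQ : DefPred j Q] :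
    DefPred j (fun v => P v ∧ Q v) := by
  obtain ⟨k, c, X, hX, h⟩ := hP.out
  obtain ⟨l, d, Y, hY, h'⟩ := hQ.out
  refine ⟨k + l, Fin.append c d, _, (hX.rename (leftVars k l n)).inter (hY.rename (rightVars k l n)), fun v => ?_⟩
  rw [h, h', ← append_comp_leftVars c d v, ← append_comp_rightVars c d v]
  rfl

instance DefPred.or (P Q : (Fin n → M) → Prop) [DefPred j P] [DefPred j Q] :
    DefPred j (fun v => P v ∨ Q v) :=
  (inferInstance : DefPred j (fun v => ¬ (¬ P v ∧ ¬ Q v))).congr fun v => by tauto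

instance DefPred.imp (P Q : (Fin n → M) → Prop) [DefPred j P] [DefPred j Q] :
    DefPred j (fun v => P v → Q v) :=
  (inferInstance : DefPred j (fun v => ¬ (P v ∧ ¬ Q v))).congr fun v => by tauto

instance DefPred.iff (P Q : (Fin n → M) → Prop) [DefPred j P] [DefPred j Q] :
    DefPred j (fun v => P v ↔ Q v) :=
  (inferInstance : DefPred j (fun v => (P v → Q v) ∧ (Q v → P v))).congr fun v => by tauto

theorem append_snoc_cast {k : ℕ} (c : Fin k → N) (v : Fin n → N) (x : N) :
    Fin.append c (Fin.snoc (α := fun _ => N) v x) =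
      Fin.snoc (α := fun _ => N) (Fin.append c v) x := by
  rw [Fin.append_snoc]

/-- A quantifier of a formula over `N` ranges over the image of `j` only. Transitivity reduces
bounded quantifiers to this case; unbounded ones are admitted only for `j = id`. -/
theorem DefPred.exists_range {P : (Fin n → M) → M → Prop}
    (h : DefPred j (fun w : Fin (n + 1) → M => P (fun i => w i.castSucc) (w (Fin.last n)))) :
    DefPred j (fun v => ∃ x, P v (j x)) := by
  obtain ⟨k, c, X, hX, h⟩ := h.out
  refine ⟨k, c, _, Dfn.proj (k := k + n) hX, fun v => exists_congr fun x => ?_⟩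
  have := h (Fin.snoc (α := fun _ => N) v x)
  rw [append_snoc_cast] at this
  simpa using this

instance (priority := high) DefPred.bex [hj : IsTransEmb j] (f : (Fin n → M) → M)
    [hf : DefTerm j f] (P : (Fin n → M) → M → Prop)
    [DefPred j (fun w : Fin (n + 1) → M => P (fun i => w i.castSucc) (w (Fin.last n)))] :
    DefPred j (fun v => ∃ x, x ∈ₘ f v ∧ P v x) := by
  have h : DefPred j (fun v => ∃ x, j x ∈ₘ f v ∧ P v (j x)) :=
    DefPred.exists_range (P := fun v x => x ∈ₘ f v ∧ P v x) inferInstance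
  obtain ⟨k, c, X, hX, h⟩ := h.out
  refine ⟨k, c, X, hX, fun v => Iff.trans ⟨?_, ?_⟩ (h v)⟩
  · rintro ⟨x, hx, hP⟩
    obtain ⟨_, _, i, hi⟩ := hf.exists_index
    obtain ⟨x, rfl⟩ := hj.trans x _ (hi v ▸ hx)
    exact ⟨x, hx, hP⟩
  · rintro ⟨x, hx⟩
    exact ⟨j x, hx⟩

instance (priority := high) DefPred.ball [IsTransEmb j] (f : (Fin n → M) → M)
    [DefTerm j f] (P : (Fin n → M) → M → Prop)
    [DefPred j (fun w : Fin (n + 1) → M => P (fun i => w i.castSucc) (w (Fin.last n)))] :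
    DefPred j (fun v => ∀ x, x ∈ₘ f v → P v x) :=
  (inferInstance : DefPred j (fun v => ¬ ∃ x, x ∈ₘ f v ∧ ¬ P v x)).congr fun v => by
    push Not; rfl

end

instance DefPred.ex {n : ℕ} (P : (Fin n → M) → M → Prop)
    [h : DefPred (id : M → M)
      (fun w : Fin (n + 1) → M => P (fun i => w i.castSucc) (w (Fin.last n)))] :
    DefPred (id : M → M) (fun v => ∃ x, P v x) :=
  DefPred.exists_range h

instance DefPred.all {n : ℕ} (P : (Fin n → M) → M → Prop)
    [DefPred (id : M → M)
      (fun w : Fin (n + 1) → M => P (fun i => w i.castSucc) (w (Fin.last n)))] :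
    DefPred (id : M → M) (fun v => ∀ x, P v x) :=
  (inferInstance : DefPred id (fun v => ¬ ∃ x, ¬ P v x)).congr fun v => by push Not; rfl

instance DefPred.existsUnique {n : ℕ} (P : (Fin n → M) → M → Prop)
    [h : DefPred (id : M → M)
      (fun w : Fin (n + 1) → M => P (fun i => w i.castSucc) (w (Fin.last n)))] :
    DefPred (id : M → M) (fun v => ∃! x, P v x) := by
  have h2 : DefPred (id : M → M) (fun w : Fin (n + 1) → M =>
      ∀ y, P (fun i => w i.castSucc) y → y = w (Fin.last n)) := by
    -- The variable for y comes after the one for x, so the renaming of `P` skips position n.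
    have := h.rename (m := n + 2)
      (Fin.snoc (α := fun _ => Fin (n + 2)) (fun i => i.castSucc.castSucc) (Fin.last (n + 1)))
    simp only [Fin.snoc_castSucc, Fin.snoc_last] at this
    infer_instance
  exact DefPred.ex (fun v x => P v x ∧ ∀ y, P v y → y = x)

section
variable {j : N → M} [IsTransEmb j] {n : ℕ} (a b c f : (Fin n → M) → M)
  [DefTerm j a] [DefTerm j b] [DefTerm j c] [DefTerm j f]

instance : DefPred j (fun v => IsEmptySet (a v)) :=
  (inferInstance : DefPred j (fun v => ∀ x, x ∈ₘ a v → ¬ x = x)).congr fun v => by simp [IsEmptySet]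

instance : DefPred j (fun v => SubsetOf (a v) (b v)) := by unfold SubsetOf; infer_instance

/-- The right-hand side has bounded quantifiers only, which makes the notion absolute for transitive
embeddings. The reformulations of pairs, successors and application below serve the same end. -/
theorem isUPair_iff {a b c : M} :
    IsUPair a b c ↔ a ∈ₘ c ∧ b ∈ₘ c ∧ ∀ z, z ∈ₘ c → z = a ∨ z = b := by
  unfold IsUPair
  grind

instance : DefPred j (fun v => IsUPair (a v) (b v) (c v)) := by
  simp only [isUPair_iff]; infer_instance

theorem isPair_iff {a b p : M} :
    IsPair a b p ↔ ∃ s, s ∈ₘ p ∧ ∃ t, t ∈ₘ p ∧ IsUPair a a s ∧ IsUPair a b t ∧ IsUPair s t p := by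
  constructor
  · rintro ⟨s, t, h1, h2, h3⟩
    exact ⟨s, (h3 s).2 (.inl rfl), t, (h3 t).2 (.inr rfl), h1, h2, h3⟩
  · rintro ⟨s, -, t, -, h⟩
    exact ⟨s, t, h⟩

instance : DefPred j (fun v => IsPair (a v) (b v) (c v)) := by
  simp only [isPair_iff]; infer_instance

theorem isSucc_iff {a b : M} :
    IsSucc a b ↔ a ∈ₘ b ∧ (∀ z, z ∈ₘ a → z ∈ₘ b) ∧ ∀ z, z ∈ₘ b → z ∈ₘ a ∨ z = a := by
  unfold IsSucc
  grind

instance : DefPred j (fun v => IsSucc (a v) (b v)) := by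
  simp only [isSucc_iff]; infer_instance

instance : DefPred j (fun v => IsTransSet (a v)) := by unfold IsTransSet; infer_instance

instance : DefPred j (fun v => IsOrd (a v)) := by unfold IsOrd; infer_instance

theorem ap_iff {f x y : M} : Ap f x y ↔ ∃ p, p ∈ₘ f ∧ IsPair x y p := by
  unfold Ap
  grind

instance : DefPred j (fun v => Ap (f v) (a v) (b v)) := by
  simp only [ap_iff]; infer_instance

end

section
variable {n : ℕ} (a b c d e f : (Fin n → M) → M) [DefTerm (id : M → M) a]
  [DefTerm (id : M → M) b] [DefTerm (id : M → M) c] [DefTerm (id : M → M) d]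
  [DefTerm (id : M → M) e] [DefTerm (id : M → M) f]

instance : DefPred (id : M → M) (fun v => IsNat (a v)) := by unfold IsNat; infer_instance

instance : DefPred (id : M → M) (fun v => IsFun (a v) (b v) (c v)) := by
  unfold IsFun IsMap; infer_instance

instance : DefPred (id : M → M) (fun v => IsIncTuple (a v) (b v) (c v)) := by
  unfold IsIncTuple IsTuple; infer_instance

instance : DefPred (id : M → M) (fun v => IsSpreadApart (a v) (b v)) := by
  unfold IsSpreadApart; infer_instance

instance : DefPred (id : M → M) (fun v => IsPartition (a v) (b v) (c v) (d v)) := by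
  unfold IsPartition IsMap; infer_instance

end

end definability

/-! ### Consequences of ZFC⁻, in the model and in its transitive submodels. -/

section closure
variable {N M : Type u} [SetModel N] [SetModel M]

/-- A term may be a parameter, which renaming variables cannot supply, so P(a, b) is expressed as ∃
x = a, ∃ y = b, P(x, y). Quantifying over the range of `j` suffices because terms take values there.
-/
theorem DefPred.subst₂ {j : N → M} [hj : IsTransEmb j] {P : M → M → Prop}
    (h : DefPred j (fun v : Fin 2 → M => P (v 0) (v 1))) {n : ℕ} (a b : (Fin n → M) → M)
    [ha : DefTerm j a] [hb : DefTerm j b] : DefPred j (fun v => P (a v) (b v)) := by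
  have h1 : DefPred j (fun w : Fin (n + 2) → M =>
      P (w (Fin.castSucc (Fin.last n))) (w (Fin.last (n + 1)))) :=
    h.rename ![Fin.castSucc (Fin.last n), Fin.last (n + 1)]
  have h2 : DefPred j (fun w : Fin (n + 1) → M => ∃ y, j y = b (fun i => w i.castSucc) ∧
      P (w (Fin.last n)) (j y)) :=
    DefPred.exists_range (P := fun (w : Fin (n + 1) → M) y => y = b (fun i => w i.castSucc) ∧
      P (w (Fin.last n)) y) inferInstance
  obtain ⟨k, c, X, hX, h⟩ :=
    (DefPred.exists_range (P := fun v x => x = a v ∧ ∃ y, j y = b v ∧ P x (j y))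
      inferInstance : DefPred j _).out
  refine ⟨k, c, X, hX, fun v => Iff.trans ?_ (h v)⟩
  obtain ⟨_, _, i, hi⟩ := ha.exists_index
  obtain ⟨_, _, i', hi'⟩ := hb.exists_index
  simp only [hi, hi']
  constructor
  · exact fun h => ⟨_, rfl, _, rfl, h⟩
  · rintro ⟨x, hx, y, hy, h⟩
    rwa [← hx, ← hy]

theorem DefPred.pullback {j : N → M} {n : ℕ} {P : (Fin n → M) → Prop} (h : DefPred j P) :
    DefPred (id : N → N) (fun v => P (fun i => j (v i))) := ⟨h.out⟩

/-- `N` is a model of `ZFC⁻`. -/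
class Model (N : Type u) [SetModel N] : Prop where
  sat : SatZFCMinus N {X | DefPred (id : N → N) (fun v : Fin 1 → N => v 0 ∈ X)}

theorem SatZFCMinus.mono {𝒟 ℰ : Set (Set N)} (h : SatZFCMinus N ℰ) (h' : 𝒟 ⊆ ℰ) :
    SatZFCMinus N 𝒟 :=
  { h with
    separation := fun X hX => h.separation X (h' hX)
    replacement := fun X hX => h.replacement X (h' hX) }

theorem IsModelOfZFCMinus.model (h : IsModelOfZFCMinus N) : Model N := by
  refine ⟨h.mono ?_⟩
  rintro X ⟨k, c, Y, hY, h⟩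
  have hX : X = {x | Fin.snoc (α := fun _ => N) c x ∈ Y} := ?_
  · exact hX ▸ hY.definable₁ c
  ext x
  refine (h fun _ => x).trans ?_
  rw [Fin.append_right_eq_snoc]
  rfl

theorem ext [Model M] {x y : M} (h : ∀ z : M, z ∈ₘ x ↔ z ∈ₘ y) : x = y :=
  Model.sat.extensionality x y h

theorem IsUPair.unique [Model M] {a b c d : M} (h : IsUPair a b c) (h' : IsUPair a b d) : c = d :=
  ext fun z => (h z).trans (h' z).symm

theorem IsPair.unique [Model M] {a b c d : M} (h : IsPair a b c) (h' : IsPair a b d) : c = d := by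
  obtain ⟨s, t, h1, h2, h3⟩ := h
  obtain ⟨s', t', h1', h2', h3'⟩ := h'
  obtain rfl := h1.unique h1'
  obtain rfl := h2.unique h2'
  exact h3.unique h3'

theorem IsUPair.inj {a b c d e : M} (h : IsUPair a b e) (h' : IsUPair c d e) :
    (a = c ∧ b = d) ∨ (a = d ∧ b = c) := by
  have h1 := h a
  have h2 := h b
  have h3 := h c
  have h4 := h d
  have h1' := h' a
  have h2' := h' b
  have h3' := h' c
  have h4' := h' d
  grind

theorem IsPair.inj {a b c d p : M} (h : IsPair a b p) (h' : IsPair c d p) : a = c ∧ b = d := by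
  obtain ⟨s, t, h1, h2, h3⟩ := h
  obtain ⟨s', t', h1', h2', h3'⟩ := h'
  rcases h3.inj h3' with ⟨rfl, rfl⟩ | ⟨rfl, rfl⟩
  · rcases h1.inj h1' with ⟨rfl, -⟩ | ⟨rfl, -⟩ <;> rcases h2.inj h2' with h | h <;> grind
  · have := h1.inj h2'
    have := h2.inj h1'
    grind

section
variable (j : N → M) [hj : IsTransEmb j]

theorem InRange.of_mem {a x : M} (h : InRange j a) (hx : x ∈ₘ a) : InRange j x := by
  obtain ⟨a, rfl⟩ := h.out
  exact ⟨hj.trans x a hx⟩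

variable [Model N]

/-- The set is formed in `N`; by transitivity its image has no further elements in `M`, so the
description holds for all z of `M`. The same argument transfers the other axioms. -/
theorem exists_sep (P : M → Prop) (a : M) [hP : DefPred j (fun v : Fin 1 → M => P (v 0))]
    [ha : InRange j a] : ∃ b, InRange j b ∧ ∀ z, z ∈ₘ b ↔ z ∈ₘ a ∧ P z := by
  obtain ⟨a, rfl⟩ := ha.out
  obtain ⟨b, hb⟩ := (Model.sat (N := N)).separation {x | P (j x)} hP.pullback a
  refine ⟨j b, ⟨b, rfl⟩, fun z => ⟨fun hz => ?_, ?_⟩⟩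
  · obtain ⟨z, rfl⟩ := hj.trans z b hz
    rw [hj.mem] at hz ⊢
    exact (hb z).1 hz
  · rintro ⟨hz, hP⟩
    obtain ⟨z, rfl⟩ := hj.trans z a hz
    rw [hj.mem] at hz ⊢
    exact (hb z).2 ⟨hz, hP⟩

theorem exists_uPair (a b : M) [ha : InRange j a] [hb : InRange j b] :
    ∃ c, InRange j c ∧ IsUPair a b c := by
  obtain ⟨a, rfl⟩ := ha.out
  obtain ⟨b, rfl⟩ := hb.out
  obtain ⟨c, hc⟩ := (Model.sat (N := N)).pairing a b
  refine ⟨j c, ⟨c, rfl⟩, fun z => ⟨fun hz => ?_, ?_⟩⟩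
  · obtain ⟨z, rfl⟩ := hj.trans z c hz
    rw [hj.mem] at hz
    exact ((hc z).1 hz).imp (congrArg j) (congrArg j)
  · rintro (rfl | rfl) <;> rw [hj.mem] <;> simp [hc _]

theorem exists_sUnion (a : M) [ha : InRange j a] :
    ∃ b, InRange j b ∧ ∀ z, z ∈ₘ b ↔ ∃ y, y ∈ₘ a ∧ z ∈ₘ y := by
  obtain ⟨a, rfl⟩ := ha.out
  obtain ⟨b, hb⟩ := (Model.sat (N := N)).union a
  refine ⟨j b, ⟨b, rfl⟩, fun z => ⟨fun hz => ?_, ?_⟩⟩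
  · obtain ⟨z, rfl⟩ := hj.trans z b hz
    rw [hj.mem] at hz
    obtain ⟨y, hy⟩ := (hb z).1 hz
    exact ⟨j y, by simpa only [hj.mem] using hy⟩
  · rintro ⟨y, hy, hz⟩
    obtain ⟨y, rfl⟩ := hj.trans y a hy
    obtain ⟨z, rfl⟩ := hj.trans z y hz
    rw [hj.mem] at *
    exact (hb z).2 ⟨y, hy, hz⟩

/-- Replacement in `N` sees only values in the range of `j`, hence the hypothesis `hr`. -/
theorem exists_image (R : M → M → Prop) (a : M)
    [hR : DefPred j (fun v : Fin 2 → M => R (v 0) (v 1))] [ha : InRange j a]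
    (hu : ∀ x y y', x ∈ₘ a → R x y → R x y' → y = y')
    (hr : ∀ x y, x ∈ₘ a → R x y → InRange j y) :
    ∃ b, InRange j b ∧ ∀ y, y ∈ₘ b ↔ ∃ x, x ∈ₘ a ∧ R x y := by
  obtain ⟨a, rfl⟩ := ha.out
  have hN : ∀ {n : ℕ} (f g : (Fin n → N) → N) [DefTerm id f] [DefTerm id g],
      DefPred (id : N → N) (fun v => R (j (f v)) (j (g v))) :=
    fun f g _ _ => DefPred.subst₂ (P := fun x y => R (j x) (j y)) hR.pullback f g
  have hp : DefPred (id : N → N) (fun v : Fin 1 → N => ∃ x y, IsPair x y (v 0) ∧ R (j x) (j y)) :=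
    inferInstance
  obtain ⟨b, hb⟩ := (Model.sat (N := N)).replacement
    {p | ∃ x y, IsPair x y p ∧ R (j x) (j y)} hp a (by
      rintro x y y' p p' hx h1 ⟨_, _, h2, h3⟩ h1' ⟨_, _, h2', h3'⟩
      obtain ⟨rfl, rfl⟩ := h1.inj h2
      obtain ⟨rfl, rfl⟩ := h1'.inj h2'
      exact hj.inj _ _ (hu _ _ _ ((hj.mem _ _).2 hx) h3 h3'))
  have hpair : ∀ x y : N, ∃ p, IsPair x y p := by
    intro x y
    obtain ⟨s, hs⟩ := (Model.sat (N := N)).pairing x x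
    obtain ⟨t, ht⟩ := (Model.sat (N := N)).pairing x y
    obtain ⟨p, hp⟩ := (Model.sat (N := N)).pairing s t
    exact ⟨p, s, t, hs, ht, hp⟩
  refine ⟨j b, ⟨b, rfl⟩, fun y => ⟨fun hy => ?_, ?_⟩⟩
  · obtain ⟨y, rfl⟩ := hj.trans y b hy
    obtain ⟨x, p, hx, h1, x', y', h2, h3⟩ := (hb y).1 ((hj.mem _ _).1 hy)
    obtain ⟨rfl, rfl⟩ := h1.inj h2
    exact ⟨j x, (hj.mem _ _).2 hx, h3⟩
  · rintro ⟨x, hx, h⟩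
    obtain ⟨y, rfl⟩ := (hr x y hx h).out
    obtain ⟨x, rfl⟩ := hj.trans x a hx
    obtain ⟨p, hp⟩ := hpair x y
    exact (hj.mem _ _).2 ((hb y).2 ⟨x, p, (hj.mem _ _).1 hx, hp, x, y, hp, h⟩)

end

section
variable [Model M]

noncomputable def upair (a b : M) : M := (exists_uPair id a b).choose

theorem isUPair_upair (a b : M) : IsUPair a b (upair a b) := (exists_uPair id a b).choose_spec.2

theorem mem_upair {a b z : M} : z ∈ₘ upair a b ↔ z = a ∨ z = b := isUPair_upair a b z

noncomputable def sUn (a : M) : M := (exists_sUnion id a).choose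

theorem mem_sUn {a z : M} : z ∈ₘ sUn a ↔ ∃ y, y ∈ₘ a ∧ z ∈ₘ y := (exists_sUnion id a).choose_spec.2 z

noncomputable def pr (a b : M) : M := upair (upair a a) (upair a b)

theorem isPair_iff_eq {a b p : M} : IsPair a b p ↔ p = pr a b := by
  have h : IsPair a b (pr a b) := ⟨_, _, isUPair_upair _ _, isUPair_upair _ _, isUPair_upair _ _⟩
  exact ⟨fun h' => h'.unique h, fun e => e ▸ h⟩

theorem isPair_pr (a b : M) : IsPair a b (pr a b) := isPair_iff_eq.2 rfl

theorem pr_inj {a b c d : M} : pr a b = pr c d ↔ a = c ∧ b = d :=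
  ⟨fun h => (isPair_pr a b).inj (h ▸ isPair_pr c d), fun ⟨h, h'⟩ => h ▸ h' ▸ rfl⟩

theorem ap_iff_pr_mem {f x y : M} : Ap f x y ↔ pr x y ∈ₘ f := by
  simp [Ap, isPair_iff_eq]

noncomputable def union (a b : M) : M := sUn (upair a b)

theorem mem_union {a b z : M} : z ∈ₘ union a b ↔ z ∈ₘ a ∨ z ∈ₘ b := by
  simp [union, mem_sUn, mem_upair]

noncomputable def insert (x a : M) : M := union a (upair x x)

theorem mem_insert {x a z : M} : z ∈ₘ insert x a ↔ z ∈ₘ a ∨ z = x := by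
  simp [insert, mem_union, mem_upair]

theorem isSucc_insert (a : M) : IsSucc a (insert a a) := fun _ => mem_insert

theorem IsSucc.unique {a b c : M} (h : IsSucc a b) (h' : IsSucc a c) : b = c :=
  ext fun z => (h z).trans (h' z).symm

theorem isSucc_iff_eq {a b : M} : IsSucc a b ↔ b = insert a a :=
  ⟨fun h => h.unique (isSucc_insert a), fun e => e ▸ isSucc_insert a⟩

theorem exists_empty : ∃ e : M, IsEmptySet e := by
  obtain ⟨_, ⟨e, he, -⟩, -⟩ := (Model.sat (N := M)).infinity
  exact ⟨e, he⟩

noncomputable def empty : M := (exists_empty (M := M)).choose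

theorem not_mem_empty (z : M) : ¬ z ∈ₘ (empty : M) := (exists_empty (M := M)).choose_spec z

theorem isEmptySet_iff_eq {a : M} : IsEmptySet a ↔ a = empty :=
  ⟨fun h => ext fun z => iff_of_false (h z) (not_mem_empty z), fun h => h ▸ not_mem_empty⟩

section
variable (j : N → M) [IsTransEmb j] [Model N]

instance InRange.upair (a b : M) [InRange j a] [InRange j b] : InRange j (upair a b) := by
  obtain ⟨c, hc, h⟩ := exists_uPair j a b
  rwa [h.unique (isUPair_upair a b)] at hc

instance InRange.sUn (a : M) [InRange j a] : InRange j (sUn a) := by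
  obtain ⟨c, hc, h⟩ := exists_sUnion j a
  rwa [ext (fun z => (h z).trans mem_sUn.symm)] at hc

instance InRange.pr (a b : M) [InRange j a] [InRange j b] : InRange j (pr a b) := by
  unfold SetModel.pr; infer_instance

instance InRange.insert (a b : M) [InRange j a] [InRange j b] : InRange j (insert a b) := by
  unfold SetModel.insert union; infer_instance

/-- A definable class function on the set `a` is a set. -/
theorem exists_map (R : M → M → Prop) (a : M)
    [hR : DefPred j (fun v : Fin 2 → M => R (v 0) (v 1))] [ha : InRange j a]
    (hu : ∀ x y y', x ∈ₘ a → R x y → R x y' → y = y')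
    (hr : ∀ x y, x ∈ₘ a → R x y → InRange j y) :
    ∃ f, InRange j f ∧ (∀ p, p ∈ₘ f → ∃ x y, IsPair x y p) ∧
      ∀ x y, Ap f x y ↔ x ∈ₘ a ∧ R x y := by
  have hs : ∀ {n : ℕ} (f g : (Fin n → M) → M) [DefTerm j f] [DefTerm j g],
      DefPred j (fun v => R (f v) (g v)) := fun f g _ _ => hR.subst₂ f g
  -- The graph is the image of a under x ↦ ⟨x, y⟩. As y is an element of an element of the pair, the
  -- quantifier over y can be bounded.
  have key : ∀ x q, (∃ s, s ∈ₘ q ∧ ∃ y, y ∈ₘ s ∧ IsPair x y q ∧ R x y) ↔ ∃ y, q = pr x y ∧ R x y := by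
    intro x q
    constructor
    · rintro ⟨_, _, y, _, h, h'⟩
      exact ⟨y, isPair_iff_eq.1 h, h'⟩
    · rintro ⟨y, rfl, h⟩
      exact ⟨SetModel.upair x y, mem_upair.2 (.inr rfl), y, mem_upair.2 (.inr rfl), isPair_pr _ _, h⟩
  obtain ⟨f, hf, h⟩ := exists_image j
    (fun x q => ∃ s, s ∈ₘ q ∧ ∃ y, y ∈ₘ s ∧ IsPair x y q ∧ R x y) a
    (by
      intro x q q' hx h h'
      obtain ⟨y, rfl, hy⟩ := (key _ _).1 h
      obtain ⟨y', rfl, hy'⟩ := (key _ _).1 h'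
      rw [hu _ _ _ hx hy hy'])
    (by
      intro x q hx h
      obtain ⟨y, rfl, hy⟩ := (key _ _).1 h
      have := hr x y hx hy
      have := InRange.of_mem j ha hx
      infer_instance)
  simp only [key] at h
  refine ⟨f, hf, fun p hp => ?_, fun x y => ?_⟩
  · obtain ⟨x, _, y, rfl, _⟩ := (h p).1 hp
    exact ⟨x, y, isPair_pr _ _⟩
  · rw [ap_iff_pr_mem, h]
    constructor
    · rintro ⟨x', hx, y', e, hR⟩
      obtain ⟨rfl, rfl⟩ := pr_inj.1 e
      exact ⟨hx, hR⟩
    · rintro ⟨hx, hR⟩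
      exact ⟨x, hx, y, rfl, hR⟩

end

theorem exists_minimal {a x : M} (h : x ∈ₘ a) : ∃ y, y ∈ₘ a ∧ ∀ z, z ∈ₘ y → ¬ z ∈ₘ a := by
  obtain ⟨y, hy, h⟩ := (Model.sat (N := M)).foundation a (fun h' => h' x h)
  exact ⟨y, hy, fun z hz hz' => h z hz' hz⟩

theorem mem_irrefl (x : M) : ¬ x ∈ₘ x := by
  intro h
  obtain ⟨y, hy, h'⟩ := exists_minimal (mem_upair.2 (.inl rfl) : x ∈ₘ upair x x)
  obtain rfl : y = x := by simpa [mem_upair] using hy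
  exact h' _ h hy

theorem mem_asymm {x y : M} (h : x ∈ₘ y) : ¬ y ∈ₘ x := by
  intro h'
  obtain ⟨z, hz, hm⟩ := exists_minimal (mem_upair.2 (.inl rfl) : x ∈ₘ upair x y)
  rcases mem_upair.1 hz with rfl | rfl
  · exact hm y h' (mem_upair.2 (.inr rfl))
  · exact hm x h (mem_upair.2 (.inl rfl))

/-- The definable predicate `P` has an `∈`-minimal counterexample in the set `a`, if any. -/
theorem exists_minimal_not (P : M → Prop) [DefPred id (fun v : Fin 1 → M => P (v 0))] {a x : M}
    (hx : x ∈ₘ a) (h : ¬ P x) : ∃ y, y ∈ₘ a ∧ ¬ P y ∧ ∀ z, z ∈ₘ y → z ∈ₘ a → P z := by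
  obtain ⟨b, -, hb⟩ := exists_sep id (fun z => ¬ P z) a
  obtain ⟨y, hy, hm⟩ := exists_minimal ((hb x).2 ⟨hx, h⟩)
  refine ⟨y, ((hb y).1 hy).1, ((hb y).1 hy).2, fun z hz hza => ?_⟩
  by_contra hP
  exact hm z hz ((hb z).2 ⟨hza, hP⟩)

/-! ### Ordinals -/

theorem IsOrd.mem {a b : M} (h : IsOrd a) (hb : b ∈ₘ a) : IsOrd b :=
  ⟨h.2 b hb, fun c hc => h.2 c (h.1 b hb c hc)⟩

theorem IsOrd.trans {a b c : M} (h : IsOrd c) (hab : a ∈ₘ b) (hb : b ∈ₘ c) : a ∈ₘ c :=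
  h.1 b hb a hab

theorem IsOrd.insert {a : M} (h : IsOrd a) : IsOrd (insert a a) := by
  refine ⟨fun y hy z hz => ?_, fun y hy => ?_⟩
  · rcases mem_insert.1 hy with hy | rfl
    · exact mem_insert.2 (.inl (h.trans hz hy))
    · exact mem_insert.2 (.inl hz)
  · rcases mem_insert.1 hy with hy | rfl
    · exact h.2 y hy
    · exact h.1

/-- Choose x minimal among those incomparable with some ordinal ≤ b, then y minimal incomparable
with x. Minimality puts every element of each into the other, so x = y. -/
theorem IsOrd.trichotomy {a b : M} (ha : IsOrd a) (hb : IsOrd b) : a ∈ₘ b ∨ a = b ∨ b ∈ₘ a := by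
  by_contra hne
  obtain ⟨x, hx, hPx, hxm⟩ := exists_minimal_not
    (fun x => ∀ y, y ∈ₘ SetModel.insert b b → x ∈ₘ y ∨ x = y ∨ y ∈ₘ x)
    (mem_insert.2 (.inr rfl) : a ∈ₘ SetModel.insert a a)
    (fun h => hne (h b (mem_insert.2 (.inr rfl))))
  push Not at hPx
  obtain ⟨y', hy', hn⟩ := hPx
  obtain ⟨y, hy, hPy, hym⟩ := exists_minimal_not (fun y => x ∈ₘ y ∨ x = y ∨ y ∈ₘ x) hy' (by tauto)
  have hox := ha.insert
  have hoy := hb.insert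
  refine hPy (.inr (.inl (ext fun z => ⟨fun hz => ?_, fun hz => ?_⟩)))
  · rcases hxm z hz (hox.trans hz hx) y hy with h | rfl | h
    · exact h
    · exact absurd (.inr (.inr hz)) hPy
    · exact absurd (.inr (.inr ((hox.mem hx).trans h hz))) hPy
  · rcases hym z hz (hoy.trans hz hy) with h | rfl | h
    · exact absurd (.inl ((hoy.mem hy).trans h hz)) hPy
    · exact absurd (.inl hz) hPy
    · exact h

theorem IsOrd.induction (P : M → Prop) [DefPred id (fun v : Fin 1 → M => P (v 0))] {a : M}
    (ha : IsOrd a) (h : ∀ b, IsOrd b → (b ∈ₘ a ∨ b = a) → (∀ c, c ∈ₘ b → P c) → P b) : P a := by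
  by_contra hP
  obtain ⟨x, hx, hPx, hm⟩ := exists_minimal_not P (mem_insert.2 (.inr rfl) : a ∈ₘ SetModel.insert a a) hP
  exact hPx (h x (ha.insert.mem hx) (mem_insert.1 hx)
    fun c hc => hm c hc (ha.insert.trans hc hx))

theorem isOrd_empty : IsOrd (empty : M) :=
  ⟨fun y h => (not_mem_empty y h).elim, fun y h => (not_mem_empty y h).elim⟩

theorem IsOrd.empty_mem_or_eq {a : M} (h : IsOrd a) : empty ∈ₘ a ∨ a = empty := by
  rcases h.trichotomy isOrd_empty with h | h | h
  · exact (not_mem_empty _ h).elim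
  · exact .inr h
  · exact .inl h

/-- Every non-empty definable class of ordinals below `a` has a least element. -/
theorem IsOrd.exists_least (P : M → Prop) [hd : DefPred id (fun v : Fin 1 → M => P (v 0))] {a x : M}
    (ha : IsOrd a) (hx : x ∈ₘ a) (h : P x) :
    ∃ y, y ∈ₘ a ∧ P y ∧ ∀ z, z ∈ₘ y → ¬ P z := by
  obtain ⟨y, hy, hP, hm⟩ := exists_minimal_not (fun y => ¬ P y) hx (not_not.2 h)
  exact ⟨y, hy, not_not.1 hP, fun z hz => hm z hz (ha.trans hz hy)⟩

theorem isNat_empty : IsNat (empty : M) := by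
  refine ⟨isOrd_empty, ?_⟩
  rintro m (h | rfl)
  · exact (not_mem_empty _ h).elim
  · exact .inl not_mem_empty

theorem IsNat.insert {n : M} (h : IsNat n) : IsNat (insert n n) := by
  refine ⟨h.1.insert, ?_⟩
  rintro m (hm | rfl)
  · exact h.2 m (mem_insert.1 hm)
  · exact .inr ⟨n, isSucc_insert n⟩

theorem IsNat.mem {m n : M} (h : IsNat n) (hm : m ∈ₘ n) : IsNat m := by
  refine ⟨h.1.mem hm, ?_⟩
  rintro k (hk | rfl)
  · exact h.2 k (.inl (h.1.trans hk hm))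
  · exact h.2 k (.inl hm)

theorem IsNat.cases {n : M} (h : IsNat n) : n = empty ∨ ∃ k, IsNat k ∧ n = SetModel.insert k k := by
  refine (h.2 n (.inr rfl)).imp isEmptySet_iff_eq.1 ?_
  rintro ⟨k, hk⟩
  exact ⟨k, h.mem ((hk k).2 (.inr rfl)), isSucc_iff_eq.1 hk⟩

theorem IsNat.induction (P : M → Prop) [DefPred id (fun v : Fin 1 → M => P (v 0))]
    (h0 : P empty) (h1 : ∀ n, IsNat n → P n → P (SetModel.insert n n)) {n : M} (hn : IsNat n) :
    P n := by
  refine hn.1.induction P fun b _ hb ih => ?_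
  have hb' : IsNat b := hb.elim hn.mem fun e => e ▸ hn
  obtain rfl | ⟨k, hk, rfl⟩ := hb'.cases
  · exact h0
  · exact h1 k hk (ih k (mem_insert.2 (.inr rfl)))

theorem IsMap.dom {f x y : M} {D C : M → Prop} (h : IsMap f D C) (hxy : Ap f x y) : D x := by
  obtain ⟨p, hp, hpf⟩ := hxy
  obtain ⟨x', y', hD, hC, hp'⟩ := h.1 p hpf
  obtain ⟨rfl, rfl⟩ := hp.inj hp'
  exact hD

theorem IsMap.cod {f x y : M} {D C : M → Prop} (h : IsMap f D C) (hxy : Ap f x y) : C y := by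
  obtain ⟨p, hp, hpf⟩ := hxy
  obtain ⟨x', y', hD, hC, hp'⟩ := h.1 p hpf
  obtain ⟨rfl, rfl⟩ := hp.inj hp'
  exact hC

theorem IsMap.unique {f x y y' : M} {D C : M → Prop} (h : IsMap f D C) (hxy : Ap f x y)
    (hxy' : Ap f x y') : y = y' :=
  (h.2 x (h.dom hxy)).unique hxy hxy'

theorem IsMap.ext {f g : M} {D C C' : M → Prop} (h : IsMap f D C) (h' : IsMap g D C')
    (hfg : ∀ x y, Ap f x y → Ap g x y) : f = g := by
  refine SetModel.ext fun p => ⟨fun hp => ?_, fun hp => ?_⟩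
  · obtain ⟨x, y, -, -, hxy⟩ := h.1 p hp
    obtain rfl := isPair_iff_eq.1 hxy
    exact ap_iff_pr_mem.1 (hfg x y (ap_iff_pr_mem.2 hp))
  · obtain ⟨x, y, hx, -, hxy⟩ := h'.1 p hp
    obtain rfl := isPair_iff_eq.1 hxy
    obtain ⟨z, hz, -⟩ := h.2 x hx
    obtain rfl := h'.unique (hfg x z hz) (ap_iff_pr_mem.2 hp)
    exact ap_iff_pr_mem.1 hz

end

end closure

/-! ### Coding standard formulas as formulas of the model. -/

section internalDefinability
variable {M : Type u} [SetModel M] [Model M]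

/-- The numeral of `M` for a standard natural number. -/
noncomputable def num : ℕ → M
  | 0 => empty
  | k + 1 => insert (num k) (num k)

theorem isNat_num (k : ℕ) : IsNat (num k : M) := by
  induction k with
  | zero => exact isNat_empty
  | succ k ih => exact ih.insert

theorem mem_num {k : ℕ} {z : M} : z ∈ₘ num k ↔ ∃ i : Fin k, z = num i := by
  induction k with
  | zero => exact iff_of_false (not_mem_empty z) (fun ⟨i, _⟩ => i.elim0)
  | succ k ih =>
    rw [num, mem_insert, ih]
    constructor
    · rintro (⟨i, rfl⟩ | rfl)
      · exact ⟨i.castSucc, rfl⟩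
      · exact ⟨Fin.last k, rfl⟩
    · rintro ⟨i, rfl⟩
      refine Fin.lastCases ?_ (fun i => ?_) i
      · exact .inr rfl
      · exact .inl ⟨i, rfl⟩

theorem num_inj {i j : ℕ} : (num i : M) = num j ↔ i = j := by
  refine ⟨fun h => ?_, congrArg _⟩
  by_contra hne
  have key : ∀ i j : ℕ, i < j → (num i : M) ≠ num j := fun i j hlt h =>
    mem_irrefl (num j : M) (by
      conv_lhs => rw [← h]
      exact mem_num.2 ⟨⟨i, hlt⟩, rfl⟩)
  rcases Nat.lt_or_gt_of_ne hne with hlt | hlt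
  · exact key i j hlt h
  · exact key j i hlt h.symm

/-- The sequence of `M` for a tuple of standard length. -/
noncomputable def tup : {k : ℕ} → (Fin k → M) → M
  | 0, _ => empty
  | k + 1, v => insert (pr (num k) (v (Fin.last k))) (tup fun i => v i.castSucc)

theorem mem_tup {k : ℕ} {v : Fin k → M} {z : M} : z ∈ₘ tup v ↔ ∃ i : Fin k, z = pr (num i) (v i) := by
  induction k with
  | zero => exact iff_of_false (not_mem_empty z) (fun ⟨i, _⟩ => i.elim0)
  | succ k ih =>
    rw [tup, mem_insert, ih]
    constructor
    · rintro (⟨i, rfl⟩ | rfl)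
      · exact ⟨i.castSucc, rfl⟩
      · exact ⟨Fin.last k, rfl⟩
    · rintro ⟨i, rfl⟩
      refine Fin.lastCases ?_ (fun i => ?_) i
      · exact .inr rfl
      · exact .inl ⟨i, rfl⟩

theorem ap_tup {k : ℕ} {v : Fin k → M} {x y : M} :
    Ap (tup v) x y ↔ ∃ i : Fin k, x = num i ∧ y = v i := by
  simp [ap_iff_pr_mem, mem_tup, pr_inj]

theorem ap_tup_num {k : ℕ} {v : Fin k → M} {i : Fin k} {y : M} :
    Ap (tup v) (num i) y ↔ y = v i := by
  rw [ap_tup]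
  constructor
  · rintro ⟨j, h, rfl⟩
    rw [Fin.ext (num_inj.1 h)]
  · exact fun h => ⟨i, rfl, h⟩

theorem tup_subset_tup {k : ℕ} {v : Fin k → M} {w : Fin (k + 1) → M} :
    SubsetOf (tup v) (tup w) ↔ v = fun i => w i.castSucc := by
  constructor
  · intro h
    funext i
    have : Ap (tup w) (num i.castSucc) (v i) := by
      rw [ap_iff_pr_mem]
      exact h _ (mem_tup.2 ⟨i, rfl⟩)
    exact ap_tup_num.1 this
  · rintro rfl z hz
    obtain ⟨i, rfl⟩ := mem_tup.1 hz
    exact mem_tup.2 ⟨i.castSucc, rfl⟩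

theorem tup_inj {k : ℕ} {v w : Fin k → M} (h : tup v = tup w) : v = w := by
  funext i
  have : Ap (tup w) (num i) (v i) := h ▸ ap_tup_num.2 rfl
  exact ap_tup_num.1 this

variable {A : M}

/-- The sequence of `M` for a tuple of standard length from `A`. -/
noncomputable def tupOf {k : ℕ} (v : Fin k → {x : M // x ∈ₘ A}) : M := tup fun i => (v i).1

theorem tupOf_inj {k : ℕ} {v w : Fin k → {x : M // x ∈ₘ A}} : tupOf v = tupOf w ↔ v = w := by
  refine ⟨fun h => ?_, congrArg _⟩
  funext i
  exact Subtype.ext (congrFun (tup_inj h) i)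

theorem isTuple_num {k : ℕ} {s : M} : IsTuple A (num k) s ↔ ∃ v : Fin k → {x : M // x ∈ₘ A}, s = tupOf v := by
  constructor
  · intro h
    have h' : ∀ i : Fin k, ∃ y, Ap s (num i) y := fun i => (h.2 (num i) (mem_num.2 ⟨i, rfl⟩)).exists
    choose v hv using h'
    refine ⟨fun i => ⟨v i, h.cod (hv i)⟩, SetModel.ext fun p => ⟨fun hp => ?_, fun hp => ?_⟩⟩
    · obtain ⟨x, y, hx, -, hxy⟩ := h.1 p hp
      obtain ⟨i, rfl⟩ := mem_num.1 hx
      obtain rfl := isPair_iff_eq.1 hxy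
      exact mem_tup.2 ⟨i, by rw [h.unique (ap_iff_pr_mem.2 hp) (hv i)]⟩
    · obtain ⟨i, rfl⟩ := mem_tup.1 hp
      exact ap_iff_pr_mem.1 (hv i)
  · rintro ⟨v, rfl⟩
    refine ⟨fun p hp => ?_, fun x hx => ?_⟩
    · obtain ⟨i, rfl⟩ := mem_tup.1 hp
      exact ⟨_, _, mem_num.2 ⟨i, rfl⟩, (v i).2, isPair_pr _ _⟩
    · obtain ⟨i, rfl⟩ := mem_num.1 hx
      exact ⟨_, ap_tup_num.2 rfl, fun y hy => ap_tup_num.1 hy⟩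

/-- Power set is not available. Instead Aᵏ⁺¹ is the union over s in Aᵏ of the sets of one-point
extensions of s, obtained by two applications of replacement; k is standard, so the induction is
external. -/
theorem exists_pow (A : M) (k : ℕ) : ∃ T, ∀ z, z ∈ₘ T ↔ IsTuple A (num k) z := by
  induction k with
  | zero =>
    refine ⟨upair empty empty, fun z => ?_⟩
    rw [isTuple_num, mem_upair, or_self]
    exact ⟨fun h => ⟨Fin.elim0, h⟩, fun ⟨_, h⟩ => h⟩
  | succ k ih =>
    obtain ⟨T, hT⟩ := ih
    have key : ∀ s x t : M, (∀ z, z ∈ₘ t ↔ z ∈ₘ s ∨ IsPair (num k : M) x z) ↔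
        t = insert (pr (num k) x) s := by
      intro s x t
      constructor
      · exact fun h => ext fun z => (h z).trans (by rw [mem_insert, isPair_iff_eq])
      · rintro rfl z
        rw [mem_insert, isPair_iff_eq]
    have h1 : ∀ s : M, ∃ Y, ∀ t, t ∈ₘ Y ↔ ∃ x, x ∈ₘ A ∧ t = insert (pr (num k) x) s := by
      intro s
      obtain ⟨Y, -, hY⟩ := exists_image (id : M → M)
        (fun x t => ∀ z, z ∈ₘ t ↔ z ∈ₘ s ∨ IsPair (num k : M) x z) A
        (fun x y y' _ h h' => by rw [(key _ _ _).1 h, (key _ _ _).1 h'])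
        (fun _ _ _ _ => inferInstance)
      exact ⟨Y, by simpa only [key] using hY⟩
    obtain ⟨Z, -, hZ⟩ := exists_image (id : M → M)
      (fun s Y => ∀ t, t ∈ₘ Y ↔ ∃ x, x ∈ₘ A ∧ ∀ z, z ∈ₘ t ↔ z ∈ₘ s ∨ IsPair (num k : M) x z) T
      (fun x y y' _ h h' => ext fun z => (h z).trans (h' z).symm)
      (fun _ _ _ _ => inferInstance)
    simp only [key] at hZ
    refine ⟨sUn Z, fun z => ?_⟩
    rw [mem_sUn, isTuple_num]
    constructor
    · rintro ⟨Y, hY, hz⟩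
      obtain ⟨s, hs, h⟩ := (hZ Y).1 hY
      obtain ⟨x, hx, rfl⟩ := (h z).1 hz
      obtain ⟨v, rfl⟩ := isTuple_num.1 ((hT s).1 hs)
      exact ⟨Fin.snoc (α := fun _ => {x : M // x ∈ₘ A}) v ⟨x, hx⟩, by simp [tupOf, tup]⟩
    · rintro ⟨v, rfl⟩
      obtain ⟨Y, hY⟩ := h1 (tupOf fun i => v i.castSucc)
      refine ⟨Y, (hZ Y).2 ⟨_, (hT _).2 (isTuple_num.2 ⟨_, rfl⟩), hY⟩, (hY _).2 ⟨_, (v _).2, rfl⟩⟩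

/-- `d` is a sequence of length `l` as in `IsDefinableRel`. -/
structure IsDefSeq (A l d : M) : Prop where
  nat : IsNat l
  map : IsMap d (fun i => i ∈ₘ l) (fun _ => True)
  step : ∀ i : M, i ∈ₘ l → ∃ m S : M, IsNat m ∧ Entry d i m S ∧ IsDefStep A d i m S

theorem entry_iff {d i n R : M} : Entry d i n R ↔ Ap d i (pr n R) := by
  simp [Entry, isPair_iff_eq]

theorem IsDefStep.mono {d d' i n R : M} (h : IsDefStep A d i n R)
    (hd : ∀ x y, Ap d x y → Ap d' x y) : IsDefStep A d' i n R := by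
  have hE : ∀ {i n R}, Entry d i n R → Entry d' i n R := fun ⟨p, h, h'⟩ => ⟨p, h, hd _ _ h'⟩
  rcases h with h | ⟨j, S, hj, hS, h⟩ | ⟨j, j', S, T, hj, hj', hS, hT, h⟩ | ⟨j, n', S, hj, hn, hS, h⟩
  · exact .inl h
  · exact .inr (.inl ⟨j, S, hj, hE hS, h⟩)
  · exact .inr (.inr (.inl ⟨j, j', S, T, hj, hj', hE hS, hE hT, h⟩))
  · exact .inr (.inr (.inr ⟨j, n', S, hj, hn, hE hS, h⟩))

theorem IsDefSeq.append {l d m S : M} (h : IsDefSeq A l d) (hm : IsNat m)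
    (hS : IsDefStep A d l m S) : ∃ l' d', IsDefSeq A l' d' ∧ SubsetOf l l' ∧
      (∀ x y, Ap d x y → Ap d' x y) ∧ ∃ i, i ∈ₘ l' ∧ Entry d' i m S := by
  have hd : ∀ x y, Ap (insert (pr l (pr m S)) d) x y ↔ Ap d x y ∨ (x = l ∧ y = pr m S) := by
    intro x y
    simp only [ap_iff_pr_mem, mem_insert, pr_inj]
  have hle : ∀ x y, Ap d x y → Ap (insert (pr l (pr m S)) d) x y := fun x y h => (hd x y).2 (.inl h)
  refine ⟨insert l l, insert (pr l (pr m S)) d, ⟨h.nat.insert, ⟨fun p hp => ?_, fun x hx => ?_⟩,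
    fun i hi => ?_⟩, fun z hz => mem_insert.2 (.inl hz), hle, l, mem_insert.2 (.inr rfl), ?_⟩
  · rcases mem_insert.1 hp with hp | rfl
    · obtain ⟨x, y, hx, -, hxy⟩ := h.map.1 p hp
      exact ⟨x, y, mem_insert.2 (.inl hx), trivial, hxy⟩
    · exact ⟨_, _, mem_insert.2 (.inr rfl), trivial, isPair_pr _ _⟩
  · rcases mem_insert.1 hx with hx | rfl
    · obtain ⟨y, hy, hu⟩ := h.map.2 x hx
      refine ⟨y, hle _ _ hy, fun z hz => ?_⟩
      rcases (hd _ _).1 hz with hz | ⟨rfl, -⟩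
      · exact hu z hz
      · exact (mem_irrefl _ hx).elim
    · refine ⟨pr m S, (hd _ _).2 (.inr ⟨rfl, rfl⟩), fun z hz => ?_⟩
      rcases (hd _ _).1 hz with hz | ⟨-, h⟩
      · exact (mem_irrefl _ (h.map.dom hz)).elim
      · exact h
  · rcases mem_insert.1 hi with hi | rfl
    · obtain ⟨m', S', hm', hE, hs⟩ := h.step i hi
      exact ⟨m', S', hm', entry_iff.2 (hle _ _ (entry_iff.1 hE)), hs.mono hle⟩
    · exact ⟨m, S, hm, entry_iff.2 ((hd _ _).2 (.inr ⟨rfl, rfl⟩)), hS.mono hle⟩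
  · exact entry_iff.2 ((hd _ _).2 (.inr ⟨rfl, rfl⟩))

theorem exists_represents {k : ℕ} (P : M → Prop) (X : Set (Fin k → {x : M // x ∈ₘ A}))
    [DefPred id (fun v : Fin 1 → M => P (v 0))] (hP : ∀ v, P (tupOf v) ↔ v ∈ X) :
    ∃ R, (∀ s, s ∈ₘ R ↔ IsTuple A (num k) s ∧ P s) ∧ ∀ s, s ∈ₘ R ↔ ∃ v, v ∈ X ∧ s = tupOf v := by
  obtain ⟨T, hT⟩ := exists_pow A k
  obtain ⟨R, -, hR⟩ := exists_sep (id : M → M) P T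
  simp only [hT] at hR
  refine ⟨R, hR, fun s => (hR s).trans ?_⟩
  rw [isTuple_num]
  constructor
  · rintro ⟨⟨v, rfl⟩, h⟩
    exact ⟨v, (hP v).1 h, rfl⟩
  · rintro ⟨v, h, rfl⟩
    exact ⟨⟨v, rfl⟩, (hP v).2 h⟩

/-- Starting from an arbitrary sequence lets a conjunction build its second conjunct on top of the
sequence for the first, with earlier entries retained. -/
theorem IsDefSeq.extend {k : ℕ} {X : Set (Fin k → {x : M // x ∈ₘ A})} (hX : Dfn _ k X) :
    ∀ {l d : M}, IsDefSeq A l d → ∃ l' d', IsDefSeq A l' d' ∧ SubsetOf l l' ∧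
      (∀ x y, Ap d x y → Ap d' x y) ∧
      ∃ R, (∃ i, i ∈ₘ l' ∧ Entry d' i (num k) R) ∧ ∀ s, s ∈ₘ R ↔ ∃ v, v ∈ X ∧ s = tupOf v := by
  have add : ∀ {k : ℕ} {X : Set (Fin k → {x : M // x ∈ₘ A})} {l d l' d' R : M},
      IsDefSeq A l' d' → SubsetOf l l' → (∀ x y, Ap d x y → Ap d' x y) →
      IsDefStep A d' l' (num k) R → (∀ s, s ∈ₘ R ↔ ∃ v, v ∈ X ∧ s = tupOf v) →
      ∃ l' d', IsDefSeq A l' d' ∧ SubsetOf l l' ∧ (∀ x y, Ap d x y → Ap d' x y) ∧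
      ∃ R, (∃ i, i ∈ₘ l' ∧ Entry d' i (num k) R) ∧ ∀ s, s ∈ₘ R ↔ ∃ v, v ∈ X ∧ s = tupOf v := by
    intro k X l d l' d' R h hl hd hs hR
    obtain ⟨l₁, d₁, h₁, hl₁, hd₁, hi⟩ := h.append (isNat_num k) hs
    exact ⟨l₁, d₁, h₁, fun z hz => hl₁ z (hl z hz), fun x y hxy => hd₁ x y (hd x y hxy), R, hi, hR⟩
  induction hX with
  | @mem k i j =>
    intro l d h
    obtain ⟨R, hR, hR'⟩ := exists_represents (A := A)
      (fun s => ∃ x y : M, Ap s (num i : M) x ∧ Ap s (num j : M) y ∧ x ∈ₘ y) {v | v i ∈ₘ v j}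
      (fun v => by simp only [tupOf, ap_tup_num]; exact ⟨fun ⟨_, _, e, e', h⟩ => by
        subst e e'; exact h, fun h => ⟨_, _, rfl, rfl, h⟩⟩)
    exact add h (fun _ h => h) (fun _ _ h => h) (.inl ⟨num i, num j, mem_num.2 ⟨i, rfl⟩,
      mem_num.2 ⟨j, rfl⟩, .inl hR⟩) hR'
  | @eq k i j =>
    intro l d h
    obtain ⟨R, hR, hR'⟩ := exists_represents (A := A)
      (fun s => ∃ x : M, Ap s (num i : M) x ∧ Ap s (num j : M) x) {v | v i = v j}
      (fun v => by simp only [tupOf, ap_tup_num]; exact ⟨fun ⟨_, e, e'⟩ => Subtype.ext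
        (e.symm.trans e'), fun h => ⟨_, rfl, congrArg Subtype.val h⟩⟩)
    exact add h (fun _ h => h) (fun _ _ h => h) (.inl ⟨num i, num j, mem_num.2 ⟨i, rfl⟩,
      mem_num.2 ⟨j, rfl⟩, .inr hR⟩) hR'
  | @compl k X _ ih =>
    intro l d h
    obtain ⟨l₁, d₁, h₁, hl₁, hd₁, S, ⟨i, hi, hE⟩, hS⟩ := ih h
    obtain ⟨R, hR, hR'⟩ := exists_represents (A := A) (fun s => ¬ s ∈ₘ S) Xᶜ
      (fun v => not_congr ((hS _).trans ⟨fun ⟨w, hw, e⟩ => tupOf_inj.1 e ▸ hw, fun h => ⟨v, h, rfl⟩⟩))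
    exact add h₁ hl₁ hd₁ (.inr (.inl ⟨i, S, hi, hE, hR⟩)) hR'
  | @inter k X Y _ _ ih ih' =>
    intro l d h
    obtain ⟨l₁, d₁, h₁, hl₁, hd₁, S, ⟨i, hi, hE⟩, hS⟩ := ih h
    obtain ⟨l₂, d₂, h₂, hl₂, hd₂, T, ⟨i', hi', hE'⟩, hT⟩ := ih' h₁
    obtain ⟨R, hR, hR'⟩ := exists_represents (A := A) (fun s => s ∈ₘ S ∧ s ∈ₘ T) (X ∩ Y)
      (fun v => and_congr
        ((hS _).trans ⟨fun ⟨w, hw, e⟩ => tupOf_inj.1 e ▸ hw, fun h => ⟨v, h, rfl⟩⟩)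
        ((hT _).trans ⟨fun ⟨w, hw, e⟩ => tupOf_inj.1 e ▸ hw, fun h => ⟨v, h, rfl⟩⟩))
    refine add h₂ (fun z hz => hl₂ z (hl₁ z hz)) (fun x y hxy => hd₂ x y (hd₁ x y hxy))
      (.inr (.inr (.inl ⟨i, i', S, T, hl₂ i hi, hi', ?_, hE', fun s => ?_⟩))) hR'
    · exact entry_iff.2 (hd₂ _ _ (entry_iff.1 hE))
    · refine (hR s).trans ⟨And.right, fun h => ⟨?_, h⟩⟩
      obtain ⟨v, -, rfl⟩ := (hS s).1 h.1
      exact isTuple_num.2 ⟨v, rfl⟩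
  | @proj k X _ ih =>
    intro l d h
    obtain ⟨l₁, d₁, h₁, hl₁, hd₁, S, ⟨i, hi, hE⟩, hS⟩ := ih h
    obtain ⟨R, hR, hR'⟩ := exists_represents (A := A) (fun s => ∃ t, t ∈ₘ S ∧ SubsetOf s t)
      {v | ∃ x, Fin.snoc (α := fun _ => {x : M // x ∈ₘ A}) v x ∈ X} (fun v => by
        constructor
        · rintro ⟨t, ht, hsub⟩
          obtain ⟨w, hw, rfl⟩ := (hS t).1 ht
          refine ⟨w (Fin.last k), ?_⟩
          have h := tup_subset_tup.1 hsub
          convert hw using 1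
          funext i
          refine Fin.lastCases ?_ (fun i => ?_) i
          · simp
          · simpa using Subtype.ext (congrFun h i)
        · rintro ⟨x, hx⟩
          refine ⟨_, (hS _).2 ⟨_, hx, rfl⟩, tup_subset_tup.2 ?_⟩
          funext i
          simp)
    exact add h₁ hl₁ hd₁ (.inr (.inr (.inr ⟨i, num (k + 1), S, hi, isSucc_insert _, hE, hR⟩))) hR'

theorem exists_isDefinableRel {k : ℕ} {X : Set (Fin k → {x : M // x ∈ₘ A})} (hX : Dfn _ k X) :
    ∃ R, IsDefinableRel A (num k) R ∧ ∀ s, s ∈ₘ R ↔ ∃ v, v ∈ X ∧ s = tupOf v := by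
  have h0 : IsDefSeq A empty empty := by
    refine ⟨isNat_empty, ⟨fun p hp => ?_, fun x hx => ?_⟩, fun i hi => ?_⟩ <;>
      exact (not_mem_empty _ ‹_›).elim
  obtain ⟨l, d, h, -, -, R, hi, hR⟩ := h0.extend hX
  exact ⟨R, ⟨l, d, h.nat, h.map, h.step, hi⟩, hR⟩

/-- Definability over the structure `⟨A, ∈⟩` implies definability inside the model. -/
theorem exists_inDef {A : M} (X : Set {x : M // x ∈ₘ A})
    (hX : DefPred (id : {x : M // x ∈ₘ A} → _) (fun v : Fin 1 → _ => v 0 ∈ X)) :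
    ∃ Y, InDef A Y ∧ ∀ z, z ∈ₘ Y ↔ ∃ h : z ∈ₘ A, ⟨z, h⟩ ∈ X := by
  obtain ⟨k, c, D, hD, h⟩ := hX.out
  obtain ⟨R, hR, hR'⟩ := exists_isDefinableRel hD
  have key : ∀ x (hx : x ∈ₘ A), (∃ t, t ∈ₘ R ∧ SubsetOf (tupOf c) t ∧ Ap t (num k) x) ↔
      (⟨x, hx⟩ : {x : M // x ∈ₘ A}) ∈ X := by
    intro x hx
    refine Iff.trans ?_ (h fun _ => ⟨x, hx⟩).symm
    rw [Fin.append_right_eq_snoc]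
    constructor
    · rintro ⟨t, ht, hsub, hap⟩
      obtain ⟨w, hw, rfl⟩ := (hR' t).1 ht
      have h1 := tup_subset_tup.1 hsub
      have h2 : x = _ := (ap_tup_num (i := Fin.last k)).1 hap
      convert hw using 1
      funext i
      refine Fin.lastCases ?_ (fun i => ?_) i
      · simpa using Subtype.ext h2
      · simpa using Subtype.ext (congrFun h1 i)
    · intro hw
      refine ⟨_, (hR' _).2 ⟨_, hw, rfl⟩, tup_subset_tup.2 ?_, (ap_tup_num (i := Fin.last k)).2 ?_⟩
      · funext i
        simp
      · simp
  obtain ⟨Y, -, hY⟩ := exists_sep (id : M → M)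
    (fun x => ∃ t, t ∈ₘ R ∧ SubsetOf (tupOf c) t ∧ Ap t (num k : M) x) A
  refine ⟨Y, ⟨fun z hz => ((hY z).1 hz).1, num k, num (k + 1), tupOf c, R, isNat_num k,
    isSucc_insert _, isTuple_num.2 ⟨c, rfl⟩, hR, fun x hx => (hY x).trans (and_iff_right hx)⟩, ?_⟩
  intro z
  rw [hY]
  exact ⟨fun h => ⟨h.1, (key z h.1).1 h.2⟩, fun ⟨h, h'⟩ => ⟨h, (key z h).2 h'⟩⟩

/-- The schemas inside `M` may include nonstandard formulas; by `exists_inDef` they cover all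
standard ones, which is all that is used. -/
theorem ThinksModelOfZFCMinus.model {l : M} (h : ThinksModelOfZFCMinus l) :
    Model {x : M // x ∈ₘ l} := by
  refine ⟨SatZFCMinus.mono h fun X hX => ?_⟩
  obtain ⟨Y, hY, h⟩ := exists_inDef X hX
  refine ⟨Y, hY, ?_⟩
  ext x
  exact ⟨fun hx => (h x.1).2 ⟨x.2, hx⟩, fun hx => ((h x.1).1 hx).2⟩

theorem isTransEmb_val {l : M} (h : IsTransSet l) :
    IsTransEmb (Subtype.val : {x : M // x ∈ₘ l} → M) :=
  ⟨fun _ _ => Subtype.ext, fun _ _ => Iff.rfl, fun x y hx => ⟨⟨x, h y.1 y.2 x hx⟩, rfl⟩⟩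

theorem inRange_val {l x : M} : InRange (Subtype.val : {x : M // x ∈ₘ l} → M) x ↔ x ∈ₘ l :=
  ⟨fun ⟨y, hy⟩ => hy ▸ y.2, fun h => ⟨⟨x, h⟩, rfl⟩⟩

theorem inDef_of_mem {l x : M} (h : IsTransSet l) (hx : x ∈ₘ l) : InDef l x := by
  have hd : DefPred (id : {x : M // x ∈ₘ l} → _) (fun v : Fin 1 → _ => v 0 ∈ₘ ⟨x, hx⟩) :=
    inferInstance
  obtain ⟨Y, hY, h'⟩ := exists_inDef {z | z ∈ₘ ⟨x, hx⟩} hd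
  suffices x = Y by rwa [this]
  refine ext fun z => Iff.trans ?_ (h' z).symm
  exact ⟨fun hz => ⟨h x hx z hz, hz⟩, fun ⟨_, hz⟩ => hz⟩

end internalDefinability

/-! ### The constructible hierarchy: transitivity, monotonicity, uniqueness. -/

section hierarchy
variable {N M : Type u} [SetModel N] [SetModel M] [Model M]

theorem InRange.empty (j : N → M) [hj : IsTransEmb j] [Model N] : InRange j (empty : M) := by
  refine ⟨(SetModel.empty : N), isEmptySet_iff_eq.1 fun z hz => ?_⟩
  obtain ⟨z, rfl⟩ := hj.trans z _ hz
  exact not_mem_empty z ((hj.mem _ _).1 hz)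

/-- A definable class function on the set `a` with values in the class `C` is a map. -/
theorem exists_isMap (j : N → M) [IsTransEmb j] [Model N] (R : M → M → Prop) (C : M → Prop) (a : M)
    [hR : DefPred j (fun v : Fin 2 → M => R (v 0) (v 1))] [ha : InRange j a]
    (he : ∀ x, x ∈ₘ a → ∃ y, R x y)
    (hu : ∀ x y y', x ∈ₘ a → R x y → R x y' → y = y')
    (hr : ∀ x y, x ∈ₘ a → R x y → InRange j y) (hC : ∀ x y, x ∈ₘ a → R x y → C y) :
    ∃ f, InRange j f ∧ IsMap f (fun x => x ∈ₘ a) C ∧ ∀ x y, Ap f x y ↔ x ∈ₘ a ∧ R x y := by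
  obtain ⟨f, hf, hp, h⟩ := exists_map j R a hu hr
  refine ⟨f, hf, ⟨fun p hpf => ?_, fun x hx => ?_⟩, h⟩
  · obtain ⟨x, y, hxy⟩ := hp p hpf
    obtain ⟨hx, hR⟩ := (h x y).1 ⟨p, hxy, hpf⟩
    exact ⟨x, y, hx, hC x y hx hR, hxy⟩
  · obtain ⟨y, hy⟩ := he x hx
    exact ⟨y, (h x y).2 ⟨hx, hy⟩, fun y' hy' => hu x y' y hx ((h x y').1 hy').2 hy⟩

theorem IsOrd.zero_or_succ_or_limit {b : M} (h : IsOrd b) :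
    IsEmptySet b ∨ (∃ c, IsSucc c b) ∨ IsLimit b := by
  by_cases h0 : IsEmptySet b
  · exact .inl h0
  · by_cases h1 : ∃ c, IsSucc c b
    · exact .inr (.inl h1)
    · exact .inr (.inr ⟨h, h0, fun y hy => h1 ⟨y, hy⟩⟩)

theorem IsOrd.le_trans {a b c : M} (h : IsOrd c) (hab : a ∈ₘ b ∨ a = b) (hbc : b ∈ₘ c ∨ b = c) :
    a ∈ₘ c ∨ a = c := by
  rcases hab with hab | rfl
  · rcases hbc with hbc | rfl
    · exact .inl (h.trans hab hbc)
    · exact .inl hab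
  · exact hbc

/-- The two claims are proved together: at a successor, transitivity of the previous level makes
each of its elements definable over it, and this inclusion yields both claims for the next level. -/
theorem IsLSeq.transitive_and_monotone {a f : M} (ha : IsOrd a) (hf : IsLSeq a f) {b : M}
    (hb : b ∈ₘ a ∨ b = a) : ∀ x, Ap f b x → IsTransSet x ∧
      ∀ c y, c ∈ₘ b → Ap f c y → SubsetOf y x := by
  have hob : IsOrd b := hb.elim ha.mem fun e => e ▸ ha
  refine hob.induction (fun b => ∀ x, Ap f b x → IsTransSet x ∧
      ∀ c y, c ∈ₘ b → Ap f c y → SubsetOf y x) ?_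
  intro c hc hcb ih x hx
  have hca := ha.le_trans hcb hb
  obtain ⟨h0, h1, h2⟩ := hf.2 c x hx
  rcases hc.zero_or_succ_or_limit with h | ⟨d, h⟩ | h
  · exact ⟨fun y hy => (h0 h y hy).elim, fun d y hd => (h d hd).elim⟩
  · have hd : d ∈ₘ c := (h d).2 (.inr rfl)
    obtain ⟨y, hy, hyu⟩ := hf.1.2 d (ha.le_trans (.inl hd) hca)
    obtain ⟨hyt, hym⟩ := ih d hd y hy
    have hx' := h1 d y h hy
    have hyx : SubsetOf y x := fun z hz => (hx' z).2 (inDef_of_mem hyt hz)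
    refine ⟨fun z hz w hw => hyx w (((hx' z).1 hz).1 w hw), fun e w he hw => ?_⟩
    rcases (h e).1 he with he | rfl
    · exact fun z hz => hyx z (hym e w he hw z hz)
    · exact hyu w hw ▸ hyx
  · have hx' := h2 h
    refine ⟨fun z hz w hw => ?_, fun d y hd hy z hz => (hx' z).2 ⟨d, y, hd, hy, hz⟩⟩
    obtain ⟨d, y, hd, hy, hzy⟩ := (hx' z).1 hz
    exact (hx' w).2 ⟨d, y, hd, hy, (ih d hd y hy).1 z hzy w hw⟩

theorem IsLSeq.unique {a a' f f' : M} (ha : IsOrd a) (ha' : IsOrd a') (hf : IsLSeq a f)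
    (hf' : IsLSeq a' f') {b : M} (hb : b ∈ₘ a ∨ b = a) (hb' : b ∈ₘ a' ∨ b = a') :
    ∀ x x', Ap f b x → Ap f' b x' → x = x' := by
  have hob : IsOrd b := hb.elim ha.mem fun e => e ▸ ha
  refine hob.induction (fun b => ∀ x x', Ap f b x → Ap f' b x' → x = x') ?_
  intro c hc hcb ih x x' hx hx'
  have hca := ha.le_trans hcb hb
  have hca' := ha'.le_trans hcb hb'
  obtain ⟨h0, h1, h2⟩ := hf.2 c x hx
  obtain ⟨h0', h1', h2'⟩ := hf'.2 c x' hx'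
  have htot : ∀ d, d ∈ₘ c → ∃ y, Ap f d y ∧ Ap f' d y := by
    intro d hd
    obtain ⟨y, hy⟩ := (hf.1.2 d (ha.le_trans (.inl hd) hca)).exists
    obtain ⟨y', hy'⟩ := (hf'.1.2 d (ha'.le_trans (.inl hd) hca')).exists
    obtain rfl := ih d hd y y' hy hy'
    exact ⟨y, hy, hy'⟩
  rcases hc.zero_or_succ_or_limit with h | ⟨d, h⟩ | h
  · exact ext fun z => iff_of_false (h0 h z) (h0' h z)
  · obtain ⟨y, hy, hy'⟩ := htot d ((h d).2 (.inr rfl))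
    exact ext fun z => (h1 d y h hy z).trans (h1' d y h hy' z).symm
  · refine ext fun z => (h2 h z).trans (Iff.trans ?_ (h2' h z).symm)
    constructor
    · rintro ⟨d, y, hd, hy, hz⟩
      obtain ⟨w, hw, hw'⟩ := htot d hd
      exact ⟨d, y, hd, ih d hd y w hy hw' ▸ hw', hz⟩
    · rintro ⟨d, y, hd, hy, hz⟩
      obtain ⟨w, hw, hw'⟩ := htot d hd
      exact ⟨d, y, hd, ih d hd w y hw hy ▸ hw, hz⟩

theorem IsL.transSet {a l : M} (h : IsL a l) : IsTransSet l := by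
  obtain ⟨ha, f, hf, hl⟩ := h
  exact (hf.transitive_and_monotone ha (.inr rfl) l hl).1

theorem IsL.unique {a l l' : M} (h : IsL a l) (h' : IsL a l') : l = l' := by
  obtain ⟨ha, f, hf, hl⟩ := h
  obtain ⟨_, f', hf', hl'⟩ := h'
  exact hf.unique ha ha hf' (.inr rfl) (.inr rfl) l l' hl hl'

theorem IsLSeq.subset {a b c f l y : M} (ha : IsOrd a) (hf : IsLSeq a f) (hl : IsL b l)
    (hca : c ∈ₘ a ∨ c = a) (hcb : c ∈ₘ b) (hy : Ap f c y) : SubsetOf y l := by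
  obtain ⟨hb, g, hg, hl⟩ := hl
  obtain ⟨y', hy'⟩ := (hg.1.2 c (.inl hcb)).exists
  rw [hf.unique ha hb hg hca (.inl hcb) y y' hy hy']
  exact (hg.transitive_and_monotone hb (.inr rfl) l hl).2 c y' hcb hy'

theorem IsL.mono {a b l m : M} (hl : IsL a l) (hm : IsL b m) (hab : a ∈ₘ b ∨ a = b) :
    SubsetOf l m := by
  rcases hab with hab | rfl
  · obtain ⟨ha, f, hf, hl⟩ := hl
    exact hf.subset ha hm (.inr rfl) hab hl
  · rw [hl.unique hm]
    exact fun _ h => h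

theorem IsL.exists_of_limit {a l z : M} (h : IsL a l) (ha : IsLimit a) (hz : z ∈ₘ l) :
    ∃ c, c ∈ₘ a ∧ ∀ b m, IsL b m → c ∈ₘ b → z ∈ₘ m := by
  obtain ⟨ho, f, hf, hl⟩ := h
  obtain ⟨c, y, hc, hy, hzy⟩ := ((hf.2 a l hl).2.2 ha z).1 hz
  exact ⟨c, hc, fun b m hm hcb => hf.subset ho hm (.inl hc) hcb hy z hzy⟩

end hierarchy

/-! ### The stages of the construction and what their levels contain. -/

section stages
variable {M : Type u} [SetModel M] [Model M] {κ A B X : M}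

/-- `b = B_n`, `x = ξ_n` and `l = L_x`. -/
structure IsStage (B X n b x l : M) : Prop where
  nat : IsNat n
  apB : Ap B n b
  apX : Ap X n x
  isL : IsL x l
  model : ThinksModelOfZFCMinus l

theorem IsOmegaConstruction.isGoodLevel (h : IsOmegaConstruction κ A B X) {n a x : M}
    (hn : IsNat n) (ha : Ap A n a) (hx : Ap X n x) : IsGoodLevel a x := by
  obtain rfl | ⟨k, hk, rfl⟩ := hn.cases
  · exact (h.zeroX _ a x not_mem_empty ha hx).2.1
  · obtain ⟨x', hx'⟩ := (h.seqX.2 k hk).exists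
    exact (h.succX k _ x' a x hk (isSucc_insert k) hx' ha hx).2.1

theorem IsOmegaConstruction.exists_stage (h : IsOmegaConstruction κ A B X) {n : M} (hn : IsNat n) :
    ∃ b x l, IsStage B X n b x l := by
  obtain ⟨a, ha⟩ := (h.seqA.2 n hn).exists
  obtain ⟨b, hb⟩ := (h.seqB.2 n hn).exists
  obtain ⟨x, hx⟩ := (h.seqX.2 n hn).exists
  obtain ⟨l, hl, -, hm⟩ := h.isGoodLevel hn ha hx
  exact ⟨b, x, l, hn, hb, hx, hl, hm⟩

theorem IsOmegaConstruction.succ_mem (h : IsOmegaConstruction κ A B X) {n x x' : M} (hn : IsNat n)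
    (hx : Ap X n x) (hx' : Ap X (insert n n) x') : x ∈ₘ x' := by
  obtain ⟨a, ha⟩ := (h.seqA.2 _ hn.insert).exists
  exact (h.succX n _ x a x' hn (isSucc_insert n) hx ha hx').1

theorem IsOmegaConstruction.antitone_and_strictMono (h : IsOmegaConstruction κ A B X) {m : M}
    (hm : IsNat m) : ∀ n, n ∈ₘ m → ∀ b b' x x', Ap B n b → Ap B m b' → Ap X n x → Ap X m x' →
      SubsetOf b' b ∧ x ∈ₘ x' := by
  refine hm.induction (fun m => ∀ n, n ∈ₘ m → ∀ b b' x x', Ap B n b → Ap B m b' → Ap X n x →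
    Ap X m x' → SubsetOf b' b ∧ x ∈ₘ x') ?_ ?_
  · exact fun n hn => (not_mem_empty n hn).elim
  · intro m hm ih n hn b b' x x' hb hb' hx hx'
    obtain ⟨c, hc⟩ := (h.seqB.2 m hm).exists
    obtain ⟨y, l, hl⟩ : ∃ y l, IsStage B X m c y l := by
      obtain ⟨c', y, l, hl⟩ := h.exists_stage hm
      rw [h.seqB.unique hc hl.apB]
      exact ⟨y, l, hl⟩
    have hsub : SubsetOf b' c := (h.succB m _ y c b' hm (isSucc_insert m) hl.apX hc hb').1
    have hmem := h.succ_mem hm hl.apX hx'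
    rcases mem_insert.1 hn with hn | rfl
    · obtain ⟨h1, h2⟩ := ih n hn b c x y hb hc hx hl.apX
      obtain ⟨_, x'', _, hl'⟩ := h.exists_stage hm.insert
      obtain rfl := h.seqX.unique hx' hl'.apX
      exact ⟨fun z hz => h1 z (hsub z hz), hl'.isL.1.trans h2 hmem⟩
    · rw [h.seqB.unique hb hc, h.seqX.unique hx hl.apX]
      exact ⟨hsub, hmem⟩

theorem IsOmegaConstruction.stage_le (h : IsOmegaConstruction κ A B X) {n b x l n' b' x' l' : M}
    (hs : IsStage B X n b x l) (hs' : IsStage B X n' b' x' l') (hle : n ∈ₘ n' ∨ n = n') :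
    SubsetOf b' b ∧ SubsetOf l l' := by
  rcases hle with hlt | rfl
  · obtain ⟨h1, h2⟩ := h.antitone_and_strictMono hs'.nat n hlt b b' x x' hs.apB hs'.apB hs.apX hs'.apX
    exact ⟨h1, hs.isL.mono hs'.isL (.inl h2)⟩
  · rw [h.seqB.unique hs.apB hs'.apB]
    exact ⟨fun _ h => h, hs.isL.mono hs'.isL (.inr (h.seqX.unique hs.apX hs'.apX))⟩

theorem IsOmegaConstruction.exists_common_stage (h : IsOmegaConstruction κ A B X)
    {n b x l n' b' x' l' : M} (hs : IsStage B X n b x l) (hs' : IsStage B X n' b' x' l') :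
    ∃ m c y k, IsStage B X m c y k ∧ SubsetOf c b ∧ SubsetOf c b' ∧ SubsetOf l k ∧
      SubsetOf l' k := by
  rcases hs.nat.1.trichotomy hs'.nat.1 with hlt | heq | hlt
  · have := h.stage_le hs hs' (.inl hlt)
    exact ⟨n', b', x', l', hs', this.1, fun _ h => h, this.2, fun _ h => h⟩
  · have := h.stage_le hs hs' (.inr heq)
    exact ⟨n', b', x', l', hs', this.1, fun _ h => h, this.2, fun _ h => h⟩
  · have := h.stage_le hs' hs (.inl hlt)
    exact ⟨n, b, x, l, hs, fun _ h => h, this.1, fun _ h => h, this.2⟩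

/-- B_n is recovered from A_{n+1} by bounded separation, as the set of z with ⟨1, z⟩ in A_{n+1}; the
two halves of the disjoint union cannot mix since 0 ≠ 1. -/
theorem IsOmegaConstruction.mem_succ_stage (h : IsOmegaConstruction κ A B X)
    {n b b' x l : M} (hn : IsNat n) (hb : Ap B n b) (hs : IsStage B X (insert n n) b' x l) :
    b ∈ₘ l := by
  obtain ⟨a, ha⟩ := (h.seqA.2 n hn).exists
  obtain ⟨a', ha'⟩ := (h.seqA.2 _ hn.insert).exists
  have hd := h.succA n _ a b a' hn (isSucc_insert n) ha hb ha'
  obtain ⟨l', hl', hal, -⟩ := h.isGoodLevel hn.insert ha' hs.apX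
  obtain rfl := hl'.unique hs.isL
  let j : {x : M // x ∈ₘ l'} → M := Subtype.val
  have := hs.model.model
  have : IsTransEmb j := isTransEmb_val hs.isL.transSet
  have : InRange j a' := inRange_val.2 hal
  have := InRange.empty j
  obtain ⟨c, hc, hc'⟩ := exists_sep j
    (fun z => ∃ p, p ∈ₘ a' ∧ IsPair (insert (empty : M) empty) z p) (sUn (sUn a'))
  suffices b = c from this ▸ inRange_val.1 hc
  refine ext fun z => ?_
  rw [hc']
  constructor
  · intro hz
    have hp : pr (insert empty empty) z ∈ₘ a' :=
      (hd _).2 (.inr ⟨empty, _, z, not_mem_empty, isSucc_insert _, hz, isPair_pr _ _⟩)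
    refine ⟨mem_sUn.2 ⟨_, mem_sUn.2 ⟨_, hp, mem_upair.2 (.inr rfl)⟩, mem_upair.2 (.inr rfl)⟩,
      _, hp, isPair_pr _ _⟩
  · rintro ⟨-, p, hp, hz⟩
    rcases (hd p).1 hp with ⟨o, y, ho, -, hy⟩ | ⟨o, i, y, ho, hi, hyb, hy⟩
    · rw [isEmptySet_iff_eq.1 ho] at hy
      exact (not_mem_empty empty ((hz.inj hy).1 ▸ mem_insert.2 (.inr rfl))).elim
    · rwa [(hz.inj hy).2]

variable {ξ lξ : M}

theorem IsOmegaConstruction.isLimit (h : IsOmegaConstruction κ A B X) (hξ : IsSupSeq X ξ)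
    (ho : IsOrd ξ) : IsLimit ξ := by
  have hmem : ∀ n x, Ap X n x → x ∈ₘ ξ := by
    intro n x hx
    have hn : IsNat n := h.seqX.dom hx
    obtain ⟨x', hx'⟩ := (h.seqX.2 _ hn.insert).exists
    exact (hξ x).2 ⟨_, x', hx', h.succ_mem hn hx hx'⟩
  refine ⟨ho, fun he => ?_, fun c hc => ?_⟩
  · obtain ⟨x, hx⟩ := (h.seqX.2 _ isNat_empty).exists
    exact he x (hmem _ x hx)
  · obtain ⟨n, x, hx, hcx⟩ := (hξ c).1 ((hc c).2 (.inr rfl))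
    rcases (hc x).1 (hmem n x hx) with h | rfl
    · exact mem_asymm h hcx
    · exact mem_irrefl _ hcx

/-- The ξ_n increase strictly, so their supremum is a limit; an element of its level appears below
some ξ_n. -/
theorem IsOmegaConstruction.exists_stage_mem (h : IsOmegaConstruction κ A B X)
    (hξ : IsSupSeq X ξ) (hl : IsL ξ lξ) {z : M} (hz : z ∈ₘ lξ) :
    ∃ n b x l, IsStage B X n b x l ∧ z ∈ₘ l := by
  obtain ⟨c, hc, hcz⟩ := hl.exists_of_limit (h.isLimit hξ hl.1) hz
  obtain ⟨n, x, hx, hcx⟩ := (hξ c).1 hc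
  obtain ⟨b, x', l, hs⟩ := h.exists_stage (h.seqX.dom hx)
  obtain rfl := h.seqX.unique hx hs.apX
  exact ⟨n, b, x, l, hs, hcz x l hs.isL hcx⟩

theorem IsOmegaConstruction.stage_subset (h : IsOmegaConstruction κ A B X)
    (hξ : IsSupSeq X ξ) (hl : IsL ξ lξ) {n b x l : M} (hs : IsStage B X n b x l) :
    SubsetOf l lξ := by
  obtain ⟨x', hx'⟩ := (h.seqX.2 _ hs.nat.insert).exists
  exact hs.isL.mono hl (.inl ((hξ x).2 ⟨_, x', hx', h.succ_mem hs.nat hs.apX hx'⟩))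

theorem IsOmegaConstruction.subset_kappa (h : IsOmegaConstruction κ A B X) {n b x l : M}
    (hs : IsStage B X n b x l) : SubsetOf b κ := by
  obtain ⟨b0, x0, l0, h0⟩ := h.exists_stage isNat_empty
  rw [← h.seqB.unique h0.apB (h.zeroB _ not_mem_empty)]
  exact (h.stage_le h0 hs (hs.nat.1.empty_mem_or_eq.imp_right Eq.symm)).1

/-- κ = B₀ is coded into A₁, so it belongs to the level of stage 1 and of every later stage. -/
theorem IsOmegaConstruction.kappa_mem (h : IsOmegaConstruction κ A B X) {n b x l : M} (hn : IsNat n)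
    (hs : IsStage B X (insert n n) b x l) : κ ∈ₘ l := by
  obtain ⟨b1, x1, l1, h1⟩ := h.exists_stage isNat_empty.insert
  refine (h.stage_le h1 hs ?_).2 _ (h.mem_succ_stage isNat_empty (h.zeroB _ not_mem_empty) h1)
  rcases hn.1.empty_mem_or_eq with hn0 | rfl
  · left
    rcases hs.nat.1.trichotomy isNat_empty.insert.1 with h2 | h2 | h2
    · rcases mem_insert.1 h2 with h2 | h2
      · exact (not_mem_empty _ h2).elim
      · exact (not_mem_empty n (h2 ▸ mem_insert.2 (.inr rfl))).elim
    · exact (mem_asymm hn0 (by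
        have : n ∈ₘ insert (empty : M) empty := h2 ▸ mem_insert.2 (.inr rfl)
        rcases mem_insert.1 this with h | rfl
        · exact (not_mem_empty _ h).elim
        · exact hn0)).elim
    · exact h2
  · exact .inr rfl

end stages

/-! ### Increasing tuples: extension, restriction, bounds. -/

section tuples
variable {M : Type u} [SetModel M] [Model M] {κ n s t α : M}

theorem IsIncTuple.isOrd (hκ : IsOrd κ) (hs : IsIncTuple κ n s) {i a : M} (h : Ap s i a) :
    IsOrd a := hκ.mem (hs.1.cod h)

theorem IsIncTuple.mem_dom (hs : IsIncTuple κ n s) {i a : M} (h : Ap s i a) : i ∈ₘ n := hs.1.dom h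

/-- An increasing tuple is determined by its range. -/
theorem IsIncTuple.eq_of_range (hκ : IsOrd κ) (hn : IsOrd n) (hs : IsIncTuple κ n s)
    (ht : IsIncTuple κ n t) (h : ∀ a, (∃ i, Ap s i a) ↔ ∃ i, Ap t i a) : s = t := by
  have key : ∀ i, i ∈ₘ n → ∀ y, Ap s i y → Ap t i y := by
    by_contra hne
    push Not at hne
    obtain ⟨x, hx, y, hy, hty⟩ := hne
    -- At the first place i of disagreement, the smaller of the two values must occur in the other
    -- tuple: not before i, where the tuples agree, and not from i on, where the values are larger.
    obtain ⟨i, hi, hP, hm⟩ := exists_minimal_not (fun i => ∀ y, Ap s i y → Ap t i y) hx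
      (fun h => hty (h y hy))
    push Not at hP
    obtain ⟨y, hy, hty⟩ := hP
    obtain ⟨y', hy'⟩ := (ht.1.2 i hi).exists
    have hlow : ∀ j z, j ∈ₘ i → Ap s j z → Ap t j z := fun j z hj => hm j hj (hn.trans hj hi) z
    rcases (hs.isOrd hκ hy).trichotomy (ht.isOrd hκ hy') with hlt | rfl | hlt
    · obtain ⟨j, hj⟩ := (h y).1 ⟨i, hy⟩
      rcases (hn.mem (ht.mem_dom hj)).trichotomy (hn.mem hi) with hji | rfl | hji
      · obtain ⟨z, hz⟩ := (hs.1.2 j (ht.mem_dom hj)).exists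
        have := ht.1.unique (hlow j z hji hz) hj
        subst this
        exact mem_irrefl _ (hs.2 j i z z hji hz hy)
      · exact hty hj
      · exact mem_asymm hlt (ht.2 i j y' y hji hy' hj)
    · exact hty hy'
    · obtain ⟨j, hj⟩ := (h y').2 ⟨i, hy'⟩
      rcases (hn.mem (hs.mem_dom hj)).trichotomy (hn.mem hi) with hji | rfl | hji
      · exact mem_irrefl _ (ht.2 j i y' y' hji (hlow j y' hji hj) hy')
      · exact hty (hs.1.unique hj hy ▸ hy')
      · exact mem_asymm hlt (hs.2 i j y y' hji hy hj)
  exact hs.1.ext ht.1 fun x y hxy => key x (hs.mem_dom hxy) y hxy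

theorem ap_of_subset {x y : M} (h : SubsetOf s t) (hxy : Ap s x y) : Ap t x y :=
  ap_iff_pr_mem.2 (h _ (ap_iff_pr_mem.1 hxy))

theorem ap_insert_pr {x y z : M} : Ap (insert (pr z α) s) x y ↔ Ap s x y ∨ (x = z ∧ y = α) := by
  simp only [ap_iff_pr_mem, mem_insert, pr_inj]

theorem IsIncTuple.snoc (hs : IsIncTuple κ n s) (hα : α ∈ₘ κ)
    (h : ∀ i a, Ap s i a → a ∈ₘ α) : IsIncTuple κ (insert n n) (insert (pr n α) s) := by
  refine ⟨⟨fun p hp => ?_, fun x hx => ?_⟩, fun i j a b hij ha hb => ?_⟩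
  · rcases mem_insert.1 hp with hp | rfl
    · obtain ⟨x, y, hx, hy, hxy⟩ := hs.1.1 p hp
      exact ⟨x, y, mem_insert.2 (.inl hx), hy, hxy⟩
    · exact ⟨n, α, mem_insert.2 (.inr rfl), hα, isPair_pr _ _⟩
  · rcases mem_insert.1 hx with hx | rfl
    · obtain ⟨y, hy, hu⟩ := hs.1.2 x hx
      refine ⟨y, ap_insert_pr.2 (.inl hy), fun z hz => ?_⟩
      rcases ap_insert_pr.1 hz with hz | ⟨rfl, -⟩
      · exact hu z hz
      · exact (mem_irrefl _ hx).elim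
    · refine ⟨α, ap_insert_pr.2 (.inr ⟨rfl, rfl⟩), fun z hz => ?_⟩
      rcases ap_insert_pr.1 hz with hz | ⟨-, h⟩
      · exact (mem_irrefl _ (hs.mem_dom hz)).elim
      · exact h
  · rcases ap_insert_pr.1 ha with h1 | ⟨rfl, rfl⟩ <;> rcases ap_insert_pr.1 hb with h2 | ⟨rfl, rfl⟩
    · exact hs.2 i j a b hij h1 h2
    · exact h i a h1
    · exact (mem_asymm hij (hs.mem_dom h2)).elim
    · exact (mem_irrefl _ hij).elim

/-- The last element of an increasing tuple bounds the others. -/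
theorem IsIncTuple.exists_bound (hκ0 : empty ∈ₘ κ) (hn : IsNat n)
    (hs : IsIncTuple κ n s) : ∃ β, β ∈ₘ κ ∧ (∀ i a, Ap s i a → a ∈ₘ β ∨ a = β) ∧
      (n = empty ∧ β = empty ∨ ∃ k, n = insert k k ∧ Ap s k β) := by
  obtain rfl | ⟨k, hk, rfl⟩ := hn.cases
  -- The empty tuple gets the bound 0, in accordance with the role of G(0) in being spread apart.
  · exact ⟨empty, hκ0, fun i a h => (not_mem_empty i (hs.mem_dom h)).elim, .inl ⟨rfl, rfl⟩⟩
  · obtain ⟨β, hβ⟩ := (hs.1.2 k (mem_insert.2 (.inr rfl))).exists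
    refine ⟨β, hs.1.cod hβ, fun i a h => ?_, .inr ⟨k, rfl, hβ⟩⟩
    rcases mem_insert.1 (hs.mem_dom h) with hi | rfl
    · exact .inl (hs.2 i k a β hi h hβ)
    · exact .inr (hs.1.unique h hβ)

/-- The restriction of an increasing `n + 1`-tuple to `n`. -/
theorem IsIncTuple.exists_restrict {N : Type u} [SetModel N] [Model N] (j : N → M) [IsTransEmb j]
    [InRange j n] [InRange j κ] [InRange j t]
    (ht : IsIncTuple κ (insert n n) t) : ∃ s, InRange j s ∧ IsIncTuple κ n s ∧ SubsetOf s t := by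
  -- Bounding i by n and a by κ keeps the separation inside `N`.
  obtain ⟨s, hsr, hs⟩ := exists_sep j (fun p => ∃ i, i ∈ₘ n ∧ ∃ a, a ∈ₘ κ ∧ IsPair i a p) t
  have hap : ∀ x y, Ap s x y ↔ Ap t x y ∧ x ∈ₘ n := by
    intro x y
    rw [ap_iff_pr_mem, hs, ap_iff_pr_mem]
    refine and_congr_right fun h => ⟨?_, fun hx => ⟨x, hx, y, ?_, isPair_pr _ _⟩⟩
    · rintro ⟨i, hi, a, -, h⟩
      rwa [(pr_inj.1 (isPair_iff_eq.1 h)).1]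
    · exact ht.1.cod (ap_iff_pr_mem.2 h)
  have hsub : SubsetOf s t := fun z hz => ((hs z).1 hz).1
  refine ⟨s, hsr, ⟨⟨fun p hp => ?_, fun x hx => ?_⟩, fun i j a b hij ha hb =>
    ht.2 i j a b hij (ap_of_subset hsub ha) (ap_of_subset hsub hb)⟩, hsub⟩
  · obtain ⟨-, i, hi, a, ha, h⟩ := (hs p).1 hp
    exact ⟨i, a, hi, ha, h⟩
  · obtain ⟨y, hy, hu⟩ := ht.1.2 x (mem_insert.2 (.inl hx))
    exact ⟨y, (hap x y).2 ⟨hy, hx⟩, fun z hz => hu z (ap_of_subset hsub hz)⟩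

theorem IsIncTuple.eq_snoc (hs : IsIncTuple κ n s) (ht : IsIncTuple κ (insert n n) t)
    (h : SubsetOf s t) (hα : Ap t n α) : t = insert (pr n α) s := by
  refine ext fun p => ⟨fun hp => ?_, fun hp => ?_⟩
  · obtain ⟨x, y, hx, -, hxy⟩ := ht.1.1 p hp
    obtain rfl := isPair_iff_eq.1 hxy
    rcases mem_insert.1 hx with hx | rfl
    · obtain ⟨z, hz⟩ := (hs.1.2 x hx).exists
      rw [ht.1.unique (ap_iff_pr_mem.2 hp) (ap_of_subset h hz)]
      exact mem_insert.2 (.inl (ap_iff_pr_mem.1 hz))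
    · rw [ht.1.unique (ap_iff_pr_mem.2 hp) hα]
      exact mem_insert.2 (.inr rfl)
  · rcases mem_insert.1 hp with hp | rfl
    · exact h p hp
    · exact ap_iff_pr_mem.1 hα

theorem IsIncTuple.eq_of_subset (hs : IsIncTuple κ n s) {s' : M} (hs' : IsIncTuple κ n s')
    (ht : IsIncTuple κ (insert n n) t) (h : SubsetOf s t) (h' : SubsetOf s' t) : s = s' := by
  refine hs.1.ext hs'.1 fun x y hxy => ?_
  obtain ⟨z, hz⟩ := (hs'.1.2 x (hs.mem_dom hxy)).exists
  rwa [ht.1.unique (ap_of_subset h hxy) (ap_of_subset h' hz)]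

theorem isIncTuple_empty : IsIncTuple κ empty s ↔ s = empty := by
  constructor
  · intro h
    refine ext fun p => iff_of_false (fun hp => ?_) (not_mem_empty p)
    obtain ⟨x, _, hx, -⟩ := h.1.1 p hp
    exact not_mem_empty x hx
  · rintro rfl
    refine ⟨⟨fun p hp => (not_mem_empty p hp).elim, fun x hx => (not_mem_empty x hx).elim⟩, ?_⟩
    rintro i j a b - ⟨p, -, hp⟩
    exact (not_mem_empty p hp).elim

end tuples

/-! ### Consequences of inaccessibility. -/

section inaccessible
variable {M : Type u} [SetModel M] [Model M] {κ : M}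

theorem IsInaccessible.nat_mem (h : IsInaccessible κ) {n : M} (hn : IsNat n) : n ∈ₘ κ := by
  obtain ⟨w, hw, hwκ⟩ := h.uncountable
  exact h.card.1.trans ((hw n).2 hn) hwκ

/-- Regularity applied to the map from 1 = {0} with value α gives b < κ above α, and α + 1 ≤ b. -/
theorem IsInaccessible.insert_mem (h : IsInaccessible κ) {α : M} (hα : α ∈ₘ κ) :
    insert α α ∈ₘ κ := by
  obtain ⟨f, -, hf, hap⟩ := exists_isMap (id : M → M) (fun _ y => y = α) (fun y => y ∈ₘ κ)
    (insert empty empty) (fun _ _ => ⟨α, rfl⟩) (fun _ _ _ _ h h' => h.trans h'.symm)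
    (fun _ _ _ _ => inferInstance) (fun _ y _ h => h ▸ hα)
  obtain ⟨b, hb, hbd⟩ := h.regular _ f (h.nat_mem isNat_empty.insert) hf
  have hαb := hbd empty α ((hap _ _).2 ⟨mem_insert.2 (.inr rfl), rfl⟩)
  rcases (h.card.1.mem hα).insert.trichotomy h.card.1 with h1 | h1 | h1
  · exact h1
  · rw [← h1] at hb
    rcases mem_insert.1 hb with hb | rfl
    · exact (mem_asymm hαb hb).elim
    · exact (mem_irrefl _ hαb).elim
  · rcases mem_insert.1 h1 with h1 | rfl
    · exact (mem_asymm h1 hα).elim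
    · exact (mem_irrefl _ hα).elim

theorem IsInaccessible.exists_max (h : IsInaccessible κ) {x y : M} (hx : x ∈ₘ κ) (hy : y ∈ₘ κ) :
    ∃ z, z ∈ₘ κ ∧ (x ∈ₘ z ∨ x = z) ∧ (y ∈ₘ z ∨ y = z) := by
  rcases (h.card.1.mem hx).trichotomy (h.card.1.mem hy) with h | h | h
  · exact ⟨y, hy, .inl h, .inr rfl⟩
  · exact ⟨y, hy, .inr h, .inr rfl⟩
  · exact ⟨x, hx, .inr rfl, .inl h⟩

/-- A subset of `κ` of size `κ` is unbounded. -/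
theorem IsInaccessible.unbounded (h : IsInaccessible κ) {b : M} (hb : SubsetOf b κ)
    (he : Equinum b κ) {β : M} (hβ : β ∈ₘ κ) : ∃ α, α ∈ₘ b ∧ β ∈ₘ α := by
  by_contra hne
  push Not at hne
  have hle : ∀ α, α ∈ₘ b → α ∈ₘ insert β β := by
    intro α hα
    rcases (h.card.1.mem hβ).trichotomy (h.card.1.mem (hb α hα)) with h1 | rfl | h1
    · exact (hne α hα h1).elim
    · exact mem_insert.2 (.inr rfl)
    · exact mem_insert.2 (.inl h1)
  obtain ⟨g, hg, hgs⟩ := he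
  -- If b were bounded by β, the bijection from b onto κ, extended by 0 to β + 1, would have bounded
  -- range by regularity.
  obtain ⟨f, -, hf, hap⟩ := exists_isMap (id : M → M)
    (fun x y => (x ∈ₘ b ∧ Ap g x y) ∨ (¬ x ∈ₘ b ∧ y = (empty : M))) (fun y => y ∈ₘ κ)
    (insert β β)
    (fun x _ => by
      by_cases hx : x ∈ₘ b
      · obtain ⟨y, hy⟩ := (hg.2 x hx).exists
        exact ⟨y, .inl ⟨hx, hy⟩⟩
      · exact ⟨empty, .inr ⟨hx, rfl⟩⟩)
    (by
      rintro x y y' - (⟨h1, h2⟩ | ⟨h1, rfl⟩) (⟨h1', h2'⟩ | ⟨h1', rfl⟩)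
      · exact hg.unique h2 h2'
      · exact (h1' h1).elim
      · exact (h1 h1').elim
      · rfl)
    (fun _ _ _ _ => inferInstance)
    (by
      rintro x y - (⟨h1, h2⟩ | ⟨h1, rfl⟩)
      · exact hg.cod h2
      · exact h.nat_mem isNat_empty)
  obtain ⟨c, hc, hbd⟩ := h.regular _ f (h.insert_mem hβ) hf
  obtain ⟨x, hx, -⟩ := hgs c hc
  exact mem_irrefl c (hbd x c ((hap x c).2 ⟨hle x (hg.dom hx), .inl ⟨hg.dom hx, hx⟩⟩))

/-- Fewer than `κ` increasing tuples have all elements `≤ α`, so the witnesses `< κ` attached to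
them are bounded. -/
theorem IsInaccessible.exists_bound (h : IsInaccessible κ) {n S : M} (hn : IsOrd n)
    (hS : ∀ s, s ∈ₘ S → IsIncTuple κ n s) (P : M → M → Prop)
    [hP : DefPred (id : M → M) (fun v : Fin 2 → M => P (v 0) (v 1))]
    (hex : ∀ s, s ∈ₘ S → ∃ θ, θ ∈ₘ κ ∧ P s θ) {α : M} (hα : α ∈ₘ κ) :
    ∃ β, β ∈ₘ κ ∧ ∀ s, s ∈ₘ S → (∀ i a, Ap s i a → a ∈ₘ α ∨ a = α) → ∃ θ, θ ∈ₘ β ∧ P s θ := by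
  have hκ := h.card.1
  have hP' : ∀ {m : ℕ} (f g : (Fin m → M) → M) [DefTerm (id : M → M) f] [DefTerm (id : M → M) g],
      DefPred (id : M → M) (fun v => P (f v) (g v)) := fun f g _ _ => hP.subst₂ f g
  -- A tuple with entries ≤ α is determined by its range, a subset of α + 1, hence by a code y < c <
  -- κ. Regularity is then applied to the map sending each code to its least witness.
  obtain ⟨p, c, hp, hc, e, he, hes⟩ := h.strongLimit _ (h.insert_mem hα)
  let K : M → M → Prop := fun y θ =>
    ∀ s, s ∈ₘ S → ∀ u, Ap e u y → (∀ a, a ∈ₘ u ↔ ∃ i, Ap s i a) → P s θ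
  have hKd : ∀ {m : ℕ} (f g : (Fin m → M) → M) [DefTerm (id : M → M) f] [DefTerm (id : M → M) g],
      DefPred (id : M → M) (fun v => K (f v) (g v)) := fun f g _ _ => by
    simp only [K]; infer_instance
  have hK : ∀ y, y ∈ₘ c → ∃ θ, θ ∈ₘ κ ∧ K y θ := by
    intro y hy
    by_cases hs : ∃ s, s ∈ₘ S ∧ ∃ u, Ap e u y ∧ ∀ a, a ∈ₘ u ↔ ∃ i, Ap s i a
    · obtain ⟨s, hs, u, hu, hus⟩ := hs
      obtain ⟨θ, hθ, hPθ⟩ := hex s hs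
      refine ⟨θ, hθ, fun s' hs' u' hu' hus' => ?_⟩
      obtain rfl := (hes y hy).unique hu hu'
      rwa [(hS s' hs').eq_of_range hκ hn (hS s hs) fun a => (hus' a).symm.trans (hus a)]
    · exact ⟨empty, h.nat_mem isNat_empty, fun s hs' u hu hus => (hs ⟨s, hs', u, hu, hus⟩).elim⟩
  obtain ⟨f, -, hf, hap⟩ := exists_isMap (id : M → M)
    (fun y θ => θ ∈ₘ κ ∧ K y θ ∧ ∀ z, z ∈ₘ θ → ¬ K y z) (fun y => y ∈ₘ κ) c
    (fun y hy => by
      obtain ⟨θ, hθ, hKθ⟩ := hK y hy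
      exact hκ.exists_least (fun θ => K y θ) hθ hKθ)
    (by
      rintro y θ θ' - ⟨h1, h2, h3⟩ ⟨h1', h2', h3'⟩
      rcases (hκ.mem h1).trichotomy (hκ.mem h1') with h4 | h4 | h4
      · exact (h3' _ h4 h2).elim
      · exact h4
      · exact (h3 _ h4 h2').elim)
    (fun _ _ _ _ => inferInstance) (fun _ _ _ h => h.1)
  obtain ⟨β, hβ, hbd⟩ := h.regular c f hc hf
  refine ⟨β, hβ, fun s hs hle => ?_⟩
  obtain ⟨u, -, hu⟩ := exists_sep (id : M → M) (fun a => ∃ i, Ap s i a) (insert α α)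
  have hu' : ∀ a, a ∈ₘ u ↔ ∃ i, Ap s i a := fun a =>
    (hu a).trans ⟨And.right, fun ⟨i, hi⟩ => ⟨mem_insert.2 (hle i a hi), i, hi⟩⟩
  have hup : u ∈ₘ p := (hp u).2 fun z hz => ((hu z).1 hz).1
  obtain ⟨y, hy⟩ := (he.2 u hup).exists
  obtain ⟨θ, hθ⟩ := (hf.2 y (he.cod hy)).exists
  exact ⟨θ, hbd y θ hθ, ((hap y θ).1 hθ).2.2.1 s hs u hy hu'⟩

end inaccessible

/-! ### Passing from (n+1)-tuples to n-tuples. -/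

section step
variable {N M : Type u} [SetModel N] [SetModel M] [Model M] {κ n γ F b S D : M}

/-- `F(s⌢a) = v` for all `a ∈ b` above `θ`, where `D` is the domain of `F`. -/
def IsTailValue (D n F b s v θ : M) : Prop :=
  ∀ a, a ∈ₘ b → θ ∈ₘ a → ∀ t, t ∈ₘ D → SubsetOf s t → Ap t n a → Ap F t v

/-- Without power set, the set of (n+1)-tuples is read off as the domain of F, and the set of
n-tuples as the set of their restrictions; every n-tuple occurs since it can be prolonged. -/
theorem IsInaccessible.exists_tuple_sets (h : IsInaccessible κ) (hn : IsNat n) (hγ : γ ∈ₘ κ)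
    (hF : IsPartition κ (insert n n) γ F) (j : N → M) [IsTransEmb j] [Model N]
    [hjκ : InRange j κ] [hjF : InRange j F] :
    ∃ S D, InRange j S ∧ InRange j D ∧ (∀ s, s ∈ₘ S ↔ IsIncTuple κ n s) ∧
      ∀ t, t ∈ₘ D ↔ IsIncTuple κ (insert n n) t := by
  have hjn : InRange j n := InRange.of_mem j hjκ (h.nat_mem hn)
  have hjγ : InRange j γ := InRange.of_mem j hjκ hγ
  have hmem : ∀ {t v p : M}, IsPair t v p → p ∈ₘ F → InRange j t := by
    rintro t v p ⟨x, y, hx, -, hp⟩ hpF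
    exact InRange.of_mem j (InRange.of_mem j (InRange.of_mem j hjF hpF) ((hp x).2 (.inl rfl)))
      ((hx t).2 (.inl rfl))
  obtain ⟨D, hjD, hD⟩ := exists_image j (fun p t => ∃ v, v ∈ₘ γ ∧ IsPair t v p) F
    (by
      rintro p t t' - ⟨v, -, hv⟩ ⟨v', -, hv'⟩
      exact (hv.inj hv').1)
    (fun p t hp ⟨v, _, hv⟩ => hmem hv hp)
  have hD' : ∀ t, t ∈ₘ D ↔ IsIncTuple κ (insert n n) t := by
    intro t
    rw [hD]
    constructor
    · rintro ⟨p, hp, v, -, hv⟩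
      exact hF.dom ⟨p, hv, hp⟩
    · intro ht
      obtain ⟨v, p, hp, hpF⟩ := (hF.2 t ht).exists
      exact ⟨p, hpF, v, hF.cod ⟨p, hp, hpF⟩, hp⟩
  have key : ∀ {t s}, t ∈ₘ D →
      ((SubsetOf s t ∧ ∀ z, z ∈ₘ t → (z ∈ₘ s ↔ ∃ i, i ∈ₘ n ∧ ∃ a, a ∈ₘ κ ∧ IsPair i a z)) ↔
        IsIncTuple κ n s ∧ SubsetOf s t) := by
    intro t s ht
    have ht' := (hD' t).1 ht
    obtain ⟨s', -, hs', hst'⟩ := ht'.exists_restrict (id : M → M)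
    have hz : ∀ z, z ∈ₘ s' ↔ z ∈ₘ t ∧ ∃ i, i ∈ₘ n ∧ ∃ a, a ∈ₘ κ ∧ IsPair i a z := by
      intro z
      constructor
      · intro hz
        obtain ⟨i, a, hi, ha, hia⟩ := hs'.1.1 z hz
        exact ⟨hst' z hz, i, hi, a, ha, hia⟩
      · rintro ⟨hz, i, hi, a, ha, hia⟩
        obtain ⟨a', ha'⟩ := (hs'.1.2 i hi).exists
        obtain rfl := ht'.1.unique ⟨z, hia, hz⟩ (ap_of_subset hst' ha')
        rw [isPair_iff_eq.1 hia]
        exact ap_iff_pr_mem.1 ha'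
    constructor
    · rintro ⟨h1, h2⟩
      obtain rfl : s = s' := ext fun z => by
        rw [hz]
        exact ⟨fun h => ⟨h1 z h, (h2 z (h1 z h)).1 h⟩, fun h => (h2 z h.1).2 h.2⟩
      exact ⟨hs', h1⟩
    · rintro ⟨h1, h2⟩
      obtain rfl := h1.eq_of_subset hs' ht' h2 hst'
      exact ⟨h2, fun z hzt => by rw [hz, and_iff_right hzt]⟩
  obtain ⟨S, hjS, hS⟩ := exists_image j (fun t s => SubsetOf s t ∧
      ∀ z, z ∈ₘ t → (z ∈ₘ s ↔ ∃ i, i ∈ₘ n ∧ ∃ a, a ∈ₘ κ ∧ IsPair i a z)) D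
    (by
      intro t s s' ht hs hs'
      obtain ⟨h1, h2⟩ := (key ht).1 hs
      obtain ⟨h1', h2'⟩ := (key ht).1 hs'
      exact h1.eq_of_subset h1' ((hD' t).1 ht) h2 h2')
    (by
      intro t s ht hs
      obtain ⟨h1, h2⟩ := (key ht).1 hs
      have : InRange j t := InRange.of_mem j hjD ht
      obtain ⟨s', hjs', h1', h2'⟩ := ((hD' t).1 ht).exists_restrict j
      rwa [h1.eq_of_subset h1' ((hD' t).1 ht) h2 h2'])
  refine ⟨S, D, hjS, hjD, fun s => ?_, hD'⟩
  rw [hS]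
  constructor
  · rintro ⟨t, ht, hs⟩
    exact ((key ht).1 hs).1
  · intro hs
    obtain ⟨β, hβ, hle, -⟩ := hs.exists_bound (h.nat_mem isNat_empty) hn
    have ht := (hD' _).2 (hs.snoc (h.insert_mem hβ) fun i a hi => mem_insert.2 (hle i a hi))
    exact ⟨_, ht, (key ht).2 ⟨hs, fun z hz => mem_insert.2 (.inl hz)⟩⟩

theorem IsTailValue.mono {s v θ θ' : M} (hb : ∀ a, a ∈ₘ b → IsOrd a)
    (h : IsTailValue D n F b s v θ) (hle : θ ∈ₘ θ' ∨ θ = θ') : IsTailValue D n F b s v θ' := by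
  intro a ha hθ
  refine h a ha ?_
  rcases hle with hle | rfl
  · exact (hb a ha).trans hle hθ
  · exact hθ

variable (hκ : IsInaccessible κ) (hn : IsNat n) (hbκ : SubsetOf b κ)
  (hunb : ∀ β, β ∈ₘ κ → ∃ α, α ∈ₘ b ∧ β ∈ₘ α)
  (hS : ∀ s, s ∈ₘ S ↔ IsIncTuple κ n s) (hD : ∀ t, t ∈ₘ D ↔ IsIncTuple κ (insert n n) t)
include hκ hn hbκ hD

/-- Some a in b exceeds both thresholds and all entries of s, and F(s⌢a) equals both values. -/
theorem IsTailValue.unique (hunb : ∀ β, β ∈ₘ κ → ∃ α, α ∈ₘ b ∧ β ∈ₘ α)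
    (hF : IsPartition κ (insert n n) γ F) {s v v' θ θ' : M} (hs : IsIncTuple κ n s)
    (hθ : θ ∈ₘ κ) (hθ' : θ' ∈ₘ κ) (h : IsTailValue D n F b s v θ)
    (h' : IsTailValue D n F b s v' θ') : v = v' := by
  have hb : ∀ a, a ∈ₘ b → IsOrd a := fun a ha => hκ.card.1.mem (hbκ a ha)
  obtain ⟨β, hβ, hle, -⟩ := hs.exists_bound (hκ.nat_mem isNat_empty) hn
  obtain ⟨δ, hδ, h1, h2⟩ := hκ.exists_max hθ hθ'
  obtain ⟨ε, hε, h3, h4⟩ := hκ.exists_max hδ hβ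
  obtain ⟨a, ha, hεa⟩ := hunb ε hε
  have hoa := hb a ha
  have hβa : β ∈ₘ a := by
    rcases h4 with h4 | rfl
    · exact hoa.trans h4 hεa
    · exact hεa
  have ht := (hD _).2 (hs.snoc (hbκ a ha) fun i c hi => by
    rcases hle i c hi with h | rfl
    · exact hoa.trans h hβa
    · exact hβa)
  have hst : SubsetOf s (insert (pr n a) s) := fun z hz => mem_insert.2 (.inl hz)
  have hta : Ap (insert (pr n a) s) n a := ap_insert_pr.2 (.inr ⟨rfl, rfl⟩)
  exact hF.unique (((h.mono hb h1).mono hb h3) a ha hεa _ ht hst hta)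
    (((h'.mono hb h2).mono hb h3) a ha hεa _ ht hst hta)

theorem exists_isTailValue (hγ : γ ∈ₘ κ) (hγ0 : ¬ IsEmptySet γ)
    (hF : IsPartition κ (insert n n) γ F) (j : N → M) [IsTransEmb j] [Model N]
    [hjκ : InRange j κ] [InRange j F] [InRange j D]
    (htail : ∀ f, IsFun f κ γ → InRange j f → ∃ θ v : M, θ ∈ₘ κ ∧ v ∈ₘ γ ∧
      ∀ a, a ∈ₘ b → (θ ∈ₘ a ∨ θ = a) → Ap f a v) {s : M} [InRange j s] (hs : IsIncTuple κ n s) :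
    ∃ v θ : M, v ∈ₘ γ ∧ θ ∈ₘ κ ∧ IsTailValue D n F b s v θ := by
  have hjn : InRange j n := InRange.of_mem j hjκ (hκ.nat_mem hn)
  have hjγ : InRange j γ := InRange.of_mem j hjκ hγ
  obtain ⟨v₀, hv₀⟩ : ∃ v, v ∈ₘ γ := by
    unfold IsEmptySet at hγ0
    push Not at hγ0
    exact hγ0
  have hjv : InRange j v₀ := InRange.of_mem j hjγ hv₀
  -- The slice α ↦ F(s⌢α), with default value v₀ where s⌢α is not increasing; it lies in the range
  -- of `j`, so `htail` applies to it.
  obtain ⟨f, hjf, hf, hap⟩ := exists_isMap j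
    (fun α v => (∃ t, t ∈ₘ D ∧ SubsetOf s t ∧ Ap t n α ∧ Ap F t v) ∨
      ((∀ t, t ∈ₘ D → SubsetOf s t → ¬ Ap t n α) ∧ v = v₀)) (fun v => v ∈ₘ γ) κ
    (by
      intro α _
      by_cases h : ∃ t, t ∈ₘ D ∧ SubsetOf s t ∧ Ap t n α
      · obtain ⟨t, ht, hst, hα⟩ := h
        obtain ⟨v, hv⟩ := (hF.2 t ((hD t).1 ht)).exists
        exact ⟨v, .inl ⟨t, ht, hst, hα, hv⟩⟩
      · exact ⟨v₀, .inr ⟨fun t ht hst hα => h ⟨t, ht, hst, hα⟩, rfl⟩⟩)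
    (by
      rintro α v v' - (⟨t, ht, hst, hα, hv⟩ | ⟨h, rfl⟩) (⟨t', ht', hst', hα', hv'⟩ | ⟨h', rfl⟩)
      · rw [hs.eq_snoc ((hD t).1 ht) hst hα] at hv
        rw [hs.eq_snoc ((hD t').1 ht') hst' hα'] at hv'
        exact hF.unique hv hv'
      · exact (h' t ht hst hα).elim
      · exact (h t' ht' hst' hα').elim
      · rfl)
    (by
      rintro α v - (⟨t, ht, hst, hα, hv⟩ | ⟨h, rfl⟩)
      · exact InRange.of_mem j hjγ (hF.cod hv)
      · exact hjv)
    (by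
      rintro α v - (⟨t, ht, hst, hα, hv⟩ | ⟨h, rfl⟩)
      · exact hF.cod hv
      · exact hv₀)
  obtain ⟨θ, v, hθ, hv, h⟩ := htail f hf hjf
  refine ⟨v, θ, hv, hθ, fun a ha hθa t ht hst hta => ?_⟩
  rcases ((hap a v).1 (h a ha (.inl hθa))).2 with ⟨t', ht', hst', hta', hv'⟩ | ⟨h', -⟩
  · rwa [hs.eq_snoc ((hD t).1 ht) hst hta, ← hs.eq_snoc ((hD t').1 ht') hst' hta']
  · exact (h' t ht hst hta).elim

include hunb hS

/-- The function sending `s` to the value of `F(s⌢a)` for almost all `a ∈ b`. -/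
theorem exists_tail_partition (hγ : γ ∈ₘ κ) (hF : IsPartition κ (insert n n) γ F)
    (hex : ∀ s, IsIncTuple κ n s → ∃ v θ : M, v ∈ₘ γ ∧ θ ∈ₘ κ ∧ IsTailValue D n F b s v θ)
    (j : N → M) [IsTransEmb j] [Model N]
    [hjκ : InRange j κ] [InRange j F] [InRange j D] [InRange j S] [InRange j b] :
    ∃ F', InRange j F' ∧ IsPartition κ n γ F' ∧
      ∀ s, IsIncTuple κ n s → ∃ v θ : M, Ap F' s v ∧ θ ∈ₘ κ ∧ IsTailValue D n F b s v θ := by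
  have hjn : InRange j n := InRange.of_mem j hjκ (hκ.nat_mem hn)
  have hjγ : InRange j γ := InRange.of_mem j hjκ hγ
  obtain ⟨F', hjF', hF', hap⟩ := exists_isMap j
    -- All quantifiers are bounded by γ, κ, b or D. This is why b itself must lie in the range of
    -- `j`.
    (fun s v => v ∈ₘ γ ∧ ∃ θ, θ ∈ₘ κ ∧ ∀ a, a ∈ₘ b → θ ∈ₘ a → ∀ t, t ∈ₘ D → SubsetOf s t →
      Ap t n a → Ap F t v) (fun v => v ∈ₘ γ) S
    (fun s hs => by
      obtain ⟨v, θ, hv, hθ, h⟩ := hex s ((hS s).1 hs)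
      exact ⟨v, hv, θ, hθ, h⟩)
    (fun s v v' hs ⟨_, θ, hθ, h⟩ ⟨_, θ', hθ', h'⟩ =>
      IsTailValue.unique hκ hn hbκ hD hunb hF ((hS s).1 hs) hθ hθ' h h')
    (fun s v _ h => InRange.of_mem j hjγ h.1) (fun s v _ h => h.1)
  have hdom : (fun s => s ∈ₘ S) = IsIncTuple κ n := funext fun s => propext (hS s)
  have hpart : IsPartition κ n γ F' := by
    unfold IsPartition
    rwa [← hdom]
  refine ⟨F', hjF', hpart, fun s hs => ?_⟩
  obtain ⟨v, hv⟩ := (hpart.2 s hs).exists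
  obtain ⟨-, -, θ, hθ, h⟩ := (hap s v).1 hv
  exact ⟨v, θ, hv, hθ, h⟩

omit hunb in
/-- A function `G` dominating `G'` such that `F(s⌢a) = F'(s)` for all `a ∈ b` above `G(α)`,
whenever the elements of `s` are at most `α`. -/
theorem exists_spreading_function {F' G' : M}
    (hF' : IsPartition κ n γ F')
    (hex : ∀ s, IsIncTuple κ n s → ∃ v θ : M, Ap F' s v ∧ θ ∈ₘ κ ∧ IsTailValue D n F b s v θ)
    (hγ : γ ∈ₘ κ) (hG' : IsFun G' κ κ) (j : N → M) [IsTransEmb j] [Model N] [hjκ : InRange j κ]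
    [InRange j F] [InRange j D] [InRange j S] [InRange j b] [InRange j F'] [InRange j G'] :
    ∃ G, InRange j G ∧ IsFun G κ κ ∧ (∀ α g g', Ap G α g → Ap G' α g' → g' ∈ₘ g) ∧
      ∀ α g s v, Ap G α g → Ap F' s v → (∀ i a, Ap s i a → a ∈ₘ α ∨ a = α) →
        IsTailValue D n F b s v g := by
  have hjn : InRange j n := InRange.of_mem j hjκ (hκ.nat_mem hn)
  have hjγ : InRange j γ := InRange.of_mem j hjκ hγ
  have hb : ∀ a, a ∈ₘ b → IsOrd a := fun a ha => hκ.card.1.mem (hbκ a ha)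
  -- With every quantifier bounded, K is definable both over `N`, which puts G into the range of
  -- `j`, and over `M`, which provides the least g.
  let K : M → M → Prop := fun α g => (∀ g', g' ∈ₘ κ → Ap G' α g' → g' ∈ₘ g) ∧
    ∀ s, s ∈ₘ S → (∀ i, i ∈ₘ n → ∀ c, c ∈ₘ κ → Ap s i c → c ∈ₘ α ∨ c = α) →
      ∀ v, v ∈ₘ γ → Ap F' s v → ∀ a, a ∈ₘ b → g ∈ₘ a → ∀ t, t ∈ₘ D → SubsetOf s t →
        Ap t n a → Ap F t v
  have hKd : ∀ {m : ℕ} (f g : (Fin m → M) → M) [DefTerm j f] [DefTerm j g],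
      DefPred j (fun v => K (f v) (g v)) := fun f g _ _ => by
    simp only [K]; infer_instance
  have hKi : ∀ {m : ℕ} (f g : (Fin m → M) → M) [DefTerm (id : M → M) f] [DefTerm (id : M → M) g],
      DefPred (id : M → M) (fun v => K (f v) (g v)) := fun f g _ _ => by
    simp only [K]; infer_instance
  have hK : ∀ α, α ∈ₘ κ → ∃ g, g ∈ₘ κ ∧ K α g := by
    intro α hα
    obtain ⟨β, hβ, h⟩ := hκ.exists_bound hn.1 (fun s hs => (hS s).1 hs)
      (fun s θ => ∀ v, Ap F' s v → ∀ a, a ∈ₘ b → θ ∈ₘ a → ∀ t, t ∈ₘ D → SubsetOf s t →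
        Ap t n a → Ap F t v)
      (fun s hs => by
        obtain ⟨v, θ, hv, hθ, h⟩ := hex s ((hS s).1 hs)
        refine ⟨θ, hθ, fun v' hv' => ?_⟩
        rw [hF'.unique hv' hv]
        exact h) hα
    obtain ⟨g', hg'⟩ := (hG'.2 α hα).exists
    obtain ⟨g, hg, h1, h2⟩ := hκ.exists_max (hκ.insert_mem (hG'.cod hg')) hβ
    refine ⟨g, hg, fun g'' _ hg'' => ?_, fun s hs hle v _ hv => ?_⟩
    · rw [hG'.unique hg'' hg']
      rcases h1 with h1 | rfl
      · exact (hκ.card.1.mem hg).trans (mem_insert.2 (.inr rfl)) h1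
      · exact mem_insert.2 (.inr rfl)
    · have hs' := (hS s).1 hs
      obtain ⟨θ, hθ, h⟩ := h s hs fun i c hc => hle i (hs'.mem_dom hc) c (hs'.1.cod hc) hc
      have h3 : IsTailValue D n F b s v θ := h v hv
      exact (h3.mono hb (.inl hθ)).mono hb h2
  obtain ⟨G, hjG, hG, hap⟩ := exists_isMap j
    (fun α g => g ∈ₘ κ ∧ K α g ∧ ∀ z, z ∈ₘ g → ¬ K α z) (fun y => y ∈ₘ κ) κ
    (fun α hα => by
      obtain ⟨g, hg, hKg⟩ := hK α hα
      exact hκ.card.1.exists_least (fun g => K α g) hg hKg)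
    (by
      rintro α g g' - ⟨h1, h2, h3⟩ ⟨h1', h2', h3'⟩
      rcases (hκ.card.1.mem h1).trichotomy (hκ.card.1.mem h1') with h4 | h4 | h4
      · exact (h3' _ h4 h2).elim
      · exact h4
      · exact (h3 _ h4 h2').elim)
    (fun _ _ _ h => InRange.of_mem j hjκ h.1) (fun _ _ _ h => h.1)
  refine ⟨G, hjG, hG, fun α g g' hg hg' => ?_, fun α g s v hg hv hle => ?_⟩
  · exact ((hap α g).1 hg).2.2.1.1 g' (hG'.cod hg') hg'
  · exact ((hap α g).1 hg).2.2.1.2 s ((hS s).2 (hF'.dom hv)) (fun i _ c _ hc => hle i c hc) v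
      (hF'.cod hv) hv

end step

/-! ### Homogeneous values for spread apart tuples. -/

section homogeneity
variable {M : Type u} [SetModel M] [Model M] {κ A B X ξ lξ γ : M}

theorem IsOmegaConstruction.isTailHomogeneous (h : IsOmegaConstruction κ A B X)
    {n b x l b' x' l' : M} (hs : IsStage B X n b x l) (hs' : IsStage B X (insert n n) b' x' l') :
    IsTailHomogeneous κ x b b' :=
  h.succB n _ x b b' hs.nat (isSucc_insert n) hs.apX hs.apB hs'.apB

theorem IsOmegaConstruction.unbounded (h : IsOmegaConstruction κ A B X) (hκ : IsInaccessible κ)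
    {n b x l : M} (hs : IsStage B X n b x l) {β : M} (hβ : β ∈ₘ κ) : ∃ α, α ∈ₘ b ∧ β ∈ₘ α := by
  obtain rfl | ⟨k, hk, rfl⟩ := hs.nat.cases
  · rw [h.seqB.unique hs.apB (h.zeroB _ not_mem_empty)]
    exact ⟨_, hκ.insert_mem hβ, mem_insert.2 (.inr rfl)⟩
  · obtain ⟨c, y, m, hs'⟩ := h.exists_stage hk
    exact hκ.unbounded (h.subset_kappa hs) (h.isTailHomogeneous hs' hs).2.1 hβ

/-- Only the last entry β of s restricts the new entry; for empty s, the convention β = 0 turns this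
into G(0) < a. -/
theorem IsSpreadApart.snoc {G n s a g β : M} (hG : IsFun G κ κ)
    (hs : IsIncTuple κ n s) (h : IsSpreadApart G s)
    (hβ : n = empty ∧ β = empty ∨ ∃ k, n = insert k k ∧ Ap s k β) (hg : Ap G β g) (hga : g ∈ₘ a) :
    IsSpreadApart G (insert (pr n a) s) := by
  constructor
  · intro o c g' ho hc hg'
    rcases ap_insert_pr.1 hc with hc | ⟨rfl, rfl⟩
    · exact h.1 o c g' ho hc hg'
    · rcases hβ with ⟨h1, rfl⟩ | ⟨k, rfl, -⟩
      · rw [h1] at hg'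
        rwa [hG.unique hg' hg]
      · exact (ho k (mem_insert.2 (.inr rfl))).elim
  · intro i j c d g' hij hc hd hg'
    have hmem : i ∈ₘ j := (hij i).2 (.inr rfl)
    rcases ap_insert_pr.1 hd with hds | ⟨rfl, rfl⟩
    · rcases ap_insert_pr.1 hc with hcs | ⟨rfl, rfl⟩
      · exact h.2 i j c d g' hij hcs hds hg'
      · exact (mem_asymm hmem (hs.mem_dom hds)).elim
    · rcases ap_insert_pr.1 hc with hcs | ⟨rfl, rfl⟩
      · rcases hβ with ⟨rfl, -⟩ | ⟨k, rfl, hk⟩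
        · exact (not_mem_empty _ hmem).elim
        · have hik : i = k := by
            rcases mem_insert.1 hmem with h1 | h1
            · rcases (hij k).1 (mem_insert.2 (.inr rfl)) with h2 | h2
              · exact (mem_asymm h1 h2).elim
              · exact h2.symm
            · exact h1
          subst hik
          rw [hs.1.unique hcs hk] at hg'
          rwa [hG.unique hg' hg]
      · exact (mem_irrefl _ hmem).elim

/-- By induction in `M`, the next entry is taken in b above the last entry and above the values of
both functions there. -/
theorem exists_spreadApart {b G G' n : M} (hκ : IsInaccessible κ) (hbκ : SubsetOf b κ)
    (hunb : ∀ β, β ∈ₘ κ → ∃ α, α ∈ₘ b ∧ β ∈ₘ α) (hG : IsFun G κ κ) (hG' : IsFun G' κ κ)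
    (hn : IsNat n) : ∃ s, IsIncTuple κ n s ∧ (∀ i a, Ap s i a → a ∈ₘ b) ∧ IsSpreadApart G s ∧
      IsSpreadApart G' s := by
  refine hn.induction (fun n => ∃ s, IsIncTuple κ n s ∧ (∀ i a, Ap s i a → a ∈ₘ b) ∧
    IsSpreadApart G s ∧ IsSpreadApart G' s) ?_ ?_
  · have h : ∀ i a : M, ¬ Ap empty i a := fun i a ⟨p, _, hp⟩ => not_mem_empty p hp
    exact ⟨empty, isIncTuple_empty.2 rfl, fun i a hi => (h i a hi).elim,
      ⟨fun o a _ _ ho => (h o a ho).elim, fun i _ a _ _ _ hi => (h i a hi).elim⟩,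
      ⟨fun o a _ _ ho => (h o a ho).elim, fun i _ a _ _ _ hi => (h i a hi).elim⟩⟩
  · rintro n hn ⟨s, hs, hsb, hsG, hsG'⟩
    obtain ⟨β, hβ, hle, hβn⟩ := hs.exists_bound (hκ.nat_mem isNat_empty) hn
    obtain ⟨g, hg⟩ := (hG.2 β hβ).exists
    obtain ⟨g', hg'⟩ := (hG'.2 β hβ).exists
    obtain ⟨δ, hδ, h1, h2⟩ := hκ.exists_max (hG.cod hg) (hG'.cod hg')
    obtain ⟨ε, hε, h3, h4⟩ := hκ.exists_max hδ hβ
    obtain ⟨a, ha, hεa⟩ := hunb ε hε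
    have hoa := hκ.card.1.mem (hbκ a ha)
    have hlt : ∀ z, (z ∈ₘ ε ∨ z = ε) → z ∈ₘ a := by
      rintro z (hz | rfl)
      · exact hoa.trans hz hεa
      · exact hεa
    have hoε := hκ.card.1.mem hε
    refine ⟨_, hs.snoc (hbκ a ha) fun i c hi => hlt c (hoε.le_trans (hle i c hi) h4),
      fun i c hi => ?_, hsG.snoc hG hs hβn hg (hlt g (hoε.le_trans h1 h3)),
      hsG'.snoc hG' hs hβn hg' (hlt g' (hoε.le_trans h2 h3))⟩
    rcases ap_insert_pr.1 hi with hi | ⟨-, rfl⟩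
    · exact hsb i c hi
    · exact ha

theorem IsOmegaConstruction.homogeneity_unique (h : IsOmegaConstruction κ A B X)
    (hκ : IsInaccessible κ) {n F : M} (hn : IsNat n) (hF : IsPartition κ n γ F)
    {m G η m' G' η' : M} (hw : IsHomogeneityWitness κ B ξ n γ F m G η)
    (hw' : IsHomogeneityWitness κ B ξ n γ F m' G' η') : η = η' := by
  obtain ⟨hm, hG, -, -, hη⟩ := hw
  obtain ⟨hm', hG', -, -, hη'⟩ := hw'
  obtain ⟨b, x, l, hs⟩ := h.exists_stage hm
  obtain ⟨b', x', l', hs'⟩ := h.exists_stage hm'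
  obtain ⟨_, c, _, _, hs'', hc, hc', -, -⟩ := h.exists_common_stage hs hs'
  obtain ⟨s, hsn, hsc, hsG, hsG'⟩ := exists_spreadApart hκ (h.subset_kappa hs'')
    (fun β hβ => h.unbounded hκ hs'' hβ) hG hG' hn
  exact hF.unique (hη b s hs.apB hsn (fun i a hi => hc a (hsc i a hi)) hsG)
    (hη' b' s hs'.apB hsn (fun i a hi => hc' a (hsc i a hi)) hsG')

theorem IsOmegaConstruction.homogeneity_zero (h : IsOmegaConstruction κ A B X)
    (hκ : IsInaccessible κ) (hξ : IsSupSeq X ξ) (hl : IsL ξ lξ) {F : M}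
    (hF : IsPartition κ empty γ F) : ∃ m G η, IsHomogeneityWitness κ B ξ empty γ F m G η := by
  -- Any G in the final level would do; stage 1 is the first whose level is known to contain κ, so
  -- the constant function 0 is formed there.
  obtain ⟨b, x, l, hs⟩ := h.exists_stage isNat_empty.insert
  let j : {x : M // x ∈ₘ l} → M := Subtype.val
  have := hs.model.model
  have : IsTransEmb j := isTransEmb_val hs.isL.transSet
  have : InRange j κ := inRange_val.2 (h.kappa_mem isNat_empty hs)
  have := InRange.empty j
  obtain ⟨G, hjG, hG, -⟩ := exists_isMap j (fun _ y => y = (empty : M)) (fun y => y ∈ₘ κ) κ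
    (fun _ _ => ⟨_, rfl⟩) (fun _ _ _ _ h h' => h.trans h'.symm) (fun _ _ _ h => h ▸ inferInstance)
    (fun _ _ _ h => h ▸ hκ.nat_mem isNat_empty)
  obtain ⟨η, hη⟩ := (hF.2 empty (isIncTuple_empty.2 rfl)).exists
  refine ⟨empty, G, η, isNat_empty, hG, ⟨lξ, hl, h.stage_subset hξ hl hs G (inRange_val.1 hjG)⟩,
    hF.cod hη, fun _ s _ hs _ _ => ?_⟩
  rwa [isIncTuple_empty.1 hs]

/-- With F at stage m, stage m+1 contains κ and the slices of F, the set `b₂` of stage m+2 is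
homogeneous for these slices, and the level of stage m+3 contains `b₂`, hence F'. The final stage p
has a level containing F' and G', and its set is contained in `b₂` and in B_{m'}. -/
theorem IsOmegaConstruction.homogeneity_succ (h : IsOmegaConstruction κ A B X)
    (hκ : IsInaccessible κ) (hξ : IsSupSeq X ξ) (hl : IsL ξ lξ) (hγ : γ ∈ₘ κ)
    (hγ0 : ¬ IsEmptySet γ) {n F : M} (hn : IsNat n)
    (ih : ∀ F, F ∈ₘ lξ → IsPartition κ n γ F → ∃ m G η, IsHomogeneityWitness κ B ξ n γ F m G η)
    (hFl : F ∈ₘ lξ) (hF : IsPartition κ (insert n n) γ F) :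
    ∃ m G η, IsHomogeneityWitness κ B ξ (insert n n) γ F m G η := by
  obtain ⟨m, b, x, l, hs, hFm⟩ := h.exists_stage_mem hξ hl hFl
  obtain ⟨b₁, x₁, l₁, hs₁⟩ := h.exists_stage hs.nat.insert
  obtain ⟨b₂, x₂, l₂, hs₂⟩ := h.exists_stage hs₁.nat.insert
  obtain ⟨b₃, x₃, l₃, hs₃⟩ := h.exists_stage hs₂.nat.insert
  have hF₁ : F ∈ₘ l₁ := (h.stage_le hs hs₁ (.inl (mem_insert.2 (.inr rfl)))).2 F hFm
  have hl₁₃ : SubsetOf l₁ l₃ := fun z hz =>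
    (h.stage_le hs₂ hs₃ (.inl (mem_insert.2 (.inr rfl)))).2 z
      ((h.stage_le hs₁ hs₂ (.inl (mem_insert.2 (.inr rfl)))).2 z hz)
  have hb₂₃ : b₂ ∈ₘ l₃ := h.mem_succ_stage hs₂.nat hs₂.apB hs₃
  have hκ₁ := h.kappa_mem hs.nat hs₁
  have hbκ := h.subset_kappa hs₂
  have hunb : ∀ β, β ∈ₘ κ → ∃ α, α ∈ₘ b₂ ∧ β ∈ₘ α := fun β hβ => h.unbounded hκ hs₂ hβ
  obtain ⟨S, D, hS₁, hD₁, hS, hD, hex⟩ : ∃ S D, S ∈ₘ l₁ ∧ D ∈ₘ l₁ ∧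
      (∀ s, s ∈ₘ S ↔ IsIncTuple κ n s) ∧ (∀ t, t ∈ₘ D ↔ IsIncTuple κ (insert n n) t) ∧
      ∀ s, IsIncTuple κ n s → ∃ v θ : M, v ∈ₘ γ ∧ θ ∈ₘ κ ∧ IsTailValue D n F b₂ s v θ := by
    let j : {x : M // x ∈ₘ l₁} → M := Subtype.val
    have := hs₁.model.model
    have : IsTransEmb j := isTransEmb_val hs₁.isL.transSet
    have : InRange j κ := inRange_val.2 hκ₁
    have : InRange j F := inRange_val.2 hF₁
    obtain ⟨S, D, hjS, hjD, hS, hD⟩ := hκ.exists_tuple_sets hn hγ hF j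
    refine ⟨S, D, inRange_val.1 hjS, inRange_val.1 hjD, hS, hD, fun s hs => ?_⟩
    have : InRange j s := InRange.of_mem j hjS ((hS s).2 hs)
    exact exists_isTailValue hκ hn hbκ hD hγ hγ0 hF j (fun f hf hjf =>
      (h.isTailHomogeneous hs₁ hs₂).2.2 f γ hγ hγ0 hf ⟨l₁, hs₁.isL, inRange_val.1 hjf⟩) hs
  obtain ⟨F', hF'₃, hF', hex'⟩ : ∃ F', F' ∈ₘ l₃ ∧ IsPartition κ n γ F' ∧
      ∀ s, IsIncTuple κ n s → ∃ v θ : M, Ap F' s v ∧ θ ∈ₘ κ ∧ IsTailValue D n F b₂ s v θ := by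
    let j : {x : M // x ∈ₘ l₃} → M := Subtype.val
    have := hs₃.model.model
    have : IsTransEmb j := isTransEmb_val hs₃.isL.transSet
    have : InRange j κ := inRange_val.2 (hl₁₃ _ hκ₁)
    have : InRange j F := inRange_val.2 (hl₁₃ _ hF₁)
    have : InRange j D := inRange_val.2 (hl₁₃ _ hD₁)
    have : InRange j S := inRange_val.2 (hl₁₃ _ hS₁)
    have : InRange j b₂ := inRange_val.2 hb₂₃
    obtain ⟨F', hjF', h'⟩ := exists_tail_partition hκ hn hbκ hunb hS hD hγ hF hex j
    exact ⟨F', inRange_val.1 hjF', h'⟩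
  obtain ⟨m', G', η, hm', hG', ⟨lξ', hlξ', hG'l⟩, hη, hw⟩ :=
    ih F' (h.stage_subset hξ hl hs₃ F' hF'₃) hF'
  rw [hlξ'.unique hl] at hG'l
  obtain ⟨_, _, _, l₄, hs₄, hG'₄⟩ := h.exists_stage_mem hξ hl hG'l
  obtain ⟨b', _, _, hs'⟩ := h.exists_stage hm'
  obtain ⟨_, b₅, _, l₅, hs₅, hb₅, -, hl₃₅, hl₄₅⟩ := h.exists_common_stage hs₃ hs₄
  obtain ⟨p, c, y, k, hsp, hc₅, hcb', hl₅k, -⟩ := h.exists_common_stage hs₅ hs'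
  have hc : SubsetOf c b₂ := fun z hz =>
    (h.stage_le hs₂ hs₃ (.inl (mem_insert.2 (.inr rfl)))).1 z (hb₅ z (hc₅ z hz))
  have hl₃k : SubsetOf l₃ k := fun z hz => hl₅k z (hl₃₅ z hz)
  obtain ⟨G, hGk, hG, hGG', hGF⟩ : ∃ G, G ∈ₘ k ∧ IsFun G κ κ ∧
      (∀ α g g', Ap G α g → Ap G' α g' → g' ∈ₘ g) ∧
      ∀ α g s v, Ap G α g → Ap F' s v → (∀ i a, Ap s i a → a ∈ₘ α ∨ a = α) →
        IsTailValue D n F b₂ s v g := by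
    let j : {x : M // x ∈ₘ k} → M := Subtype.val
    have := hsp.model.model
    have : IsTransEmb j := isTransEmb_val hsp.isL.transSet
    have : InRange j κ := inRange_val.2 (hl₃k _ (hl₁₃ _ hκ₁))
    have : InRange j F := inRange_val.2 (hl₃k _ (hl₁₃ _ hF₁))
    have : InRange j D := inRange_val.2 (hl₃k _ (hl₁₃ _ hD₁))
    have : InRange j S := inRange_val.2 (hl₃k _ (hl₁₃ _ hS₁))
    have : InRange j b₂ := inRange_val.2 (hl₃k _ hb₂₃)
    have : InRange j F' := inRange_val.2 (hl₃k _ hF'₃)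
    have : InRange j G' := inRange_val.2 (hl₅k _ (hl₄₅ _ hG'₄))
    obtain ⟨G, hjG, h'⟩ := exists_spreading_function hκ hn hbκ hS hD hF' hex' hγ hG' j
    exact ⟨G, inRange_val.1 hjG, h'⟩
  refine ⟨p, G, η, hsp.nat, hG, ⟨lξ, hl, h.stage_subset hξ hl hsp G hGk⟩, hη, ?_⟩
  intro c' t hc' ht htc htG
  obtain rfl := h.seqB.unique hc' hsp.apB
  obtain ⟨s, -, hsn, hst⟩ := ht.exists_restrict (id : M → M)
  have hκo := hκ.card.1
  -- G dominates G' pointwise.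
  have hsG' : IsSpreadApart G' s := by
    refine ⟨fun o a g' ho ha hg' => ?_, fun i j a b g' hij ha hb hg' => ?_⟩
    · obtain ⟨g, hg⟩ := (hG.2 o (hG'.dom hg')).exists
      exact (hκo.mem (hsn.1.cod ha)).trans (hGG' o g g' hg hg')
        (htG.1 o a g ho (ap_of_subset hst ha) hg)
    · obtain ⟨g, hg⟩ := (hG.2 a (hG'.dom hg')).exists
      exact (hκo.mem (hsn.1.cod hb)).trans (hGG' a g g' hg hg')
        (htG.2 i j a b g hij (ap_of_subset hst ha) (ap_of_subset hst hb) hg)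
  have hF's : Ap F' s η := hw b' s hs'.apB hsn
    (fun i a hi => hcb' a (htc i a (ap_of_subset hst hi))) hsG'
  obtain ⟨β, hβ, hle, hβn⟩ := hsn.exists_bound (hκ.nat_mem isNat_empty) hn
  obtain ⟨g, hg⟩ := (hG.2 β hβ).exists
  obtain ⟨a, ha⟩ := (ht.1.2 n (mem_insert.2 (.inr rfl))).exists
  -- The remaining condition is G(β) < a, for β the last entry of s or 0; it is an instance of t
  -- being G spread apart.
  refine hGF β g s η hg hF's hle a (hc a (htc n a ha)) ?_ t ((hD t).2 ht) hst ha
  rcases hβn with ⟨rfl, rfl⟩ | ⟨i, rfl, hi⟩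
  · exact htG.1 _ a g not_mem_empty ha hg
  · exact htG.2 i _ β a g (isSucc_insert i) (ap_of_subset hst hi) ha hg

theorem IsOmegaConstruction.exists_homogeneityWitness (h : IsOmegaConstruction κ A B X)
    (hκ : IsInaccessible κ) (hξ : IsSupSeq X ξ) (hl : IsL ξ lξ) (hγ : γ ∈ₘ κ)
    (hγ0 : ¬ IsEmptySet γ) {n : M} (hn : IsNat n) : ∀ F, F ∈ₘ lξ → IsPartition κ n γ F →
      ∃ m G η, IsHomogeneityWitness κ B ξ n γ F m G η := by
  -- Replacing membership in the hierarchy by membership in the fixed set `lξ` lets instance search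
  -- see that the induction predicate is definable.
  have key : ∀ n F m G η, IsHomogeneityWitness κ B ξ n γ F m G η ↔
      IsNat m ∧ IsFun G κ κ ∧ G ∈ₘ lξ ∧ η ∈ₘ γ ∧ ∀ b s : M, Ap B m b → IsIncTuple κ n s →
        (∀ i a : M, Ap s i a → a ∈ₘ b) → IsSpreadApart G s → Ap F s η := by
    intro n F m G η
    have : InL G ξ ↔ G ∈ₘ lξ := ⟨fun ⟨l, h', hG⟩ => h'.unique hl ▸ hG, fun hG => ⟨lξ, hl, hG⟩⟩
    rw [IsHomogeneityWitness, this]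
  have hd : DefPred (id : M → M) (fun v : Fin 1 → M => ∀ F, F ∈ₘ lξ → IsPartition κ (v 0) γ F →
      ∃ m G η, IsHomogeneityWitness κ B ξ (v 0) γ F m G η) := by
    simp only [key]
    infer_instance
  exact hn.induction (fun n => ∀ F, F ∈ₘ lξ → IsPartition κ n γ F →
      ∃ m G η, IsHomogeneityWitness κ B ξ n γ F m G η)
    (fun F _ hF => h.homogeneity_zero hκ hξ hl hF)
    (fun n hn ih F hFl hF => h.homogeneity_succ hκ hξ hl hγ hγ0 hn ih hFl hF)

end homogeneity

end SetModel

open SetModel in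
theorem mainTheorem4 {M : Type u} [SetModel M] (κ : M) (hM : IsGroundModel κ)
    (A B X ξ : M) (hABX : IsOmegaConstruction κ A B X) (hξ : IsSupSeq X ξ)
    (n γ F : M) (hn : IsNat n) (hγ : γ ∈ₘ κ) (hγ0 : ¬ IsEmptySet γ)
    (hF : IsPartition κ n γ F) (hFξ : InL F ξ) :
    (∃ m G η : M, IsHomogeneityWitness κ B ξ n γ F m G η) ∧
    (∀ m G η m' G' η' : M, IsHomogeneityWitness κ B ξ n γ F m G η →
      IsHomogeneityWitness κ B ξ n γ F m' G' η' → η = η') := by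
  have := hM.zfc.model
  have hκ := hM.weaklyCompact.1
  obtain ⟨lξ, hl, hFl⟩ := hFξ
  exact ⟨hABX.exists_homogeneityWitness hκ hξ hl hγ hγ0 hn F hFl hF,
    fun _ _ _ _ _ _ hw hw' => hABX.homogeneity_unique hκ hn hF hw hw'⟩
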